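/- Let $n\ge 1$. For a Lebesgue measurable set $E\subset\mathbb R^n$ write $\mathbf 1_E$ for its indicator function; $E$ is said to have finite perimeter if the distributional gradient $\nabla\mathbf 1_E$ is a finite $\mathbb R^n$-valued measure, with total variation measure $|\nabla\mathbf 1_E|$ (the set $E$ need be neither bounded nor of finite volume). The reduced boundary $\partial^*E$ is the set of points $x$ such that $|\nabla \mathbf 1_E|(B_r(x))>0$ for all $r>0$ and the limit $\lim_{r\to0^+}\nabla\mathbf 1_E(B_r(x))/|\nabla\mathbf 1_E|(B_r(x))$ exists and is a unit vector. Here $B_r(x)$ is the open ball of radius $r$ centred at $x$. For $\varepsilon>0$ let $\varphi_\varepsilon:=\mathbf 1_E*\gamma_{n,\varepsilon}$, where $\gamma_{n,\varepsilon}(x)=\varepsilon^{-n}\gamma_n(x/\varepsilon)$ and $\gamma_n(x)=(2\pi)^{-n/2}e^{-|x|^2/2}$ is the standard Gaussian density. There is a constant $c_n>0$ depending only on the dimension $n$ such that, for every set $E\subset\mathbb R^n$ of finite perimeter, every $x_0\in\partial^*E$ and every $r_0>0$, $$ \liminf_{\varepsilon\to 0^+}\frac{1}{|\log\varepsilon|}\int_{B_{r_0}(x_0)}\int_{B_{r_0}(x_0)}\frac{|\varphi_\varepsilon(x)-\varphi_\varepsilon(y)|^2}{|x-y|^{n+1}}\,dx\,dy\;\ge\;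 c_n\,\mathcal H^{n-1}\bigl(\partial^*E\cap B_{r_0/2}(x_0)\bigr), $$ where $\mathcal H^{n-1}$ is the $(n-1)$-dimensional Hausdorff measure. -/

import Mathlib

open MeasureTheory Set Filter Topology
open scoped ENNReal

noncomputable section

/-- The divergence of a vector field on `ℝⁿ`. -/
def divergence {n : ℕ} (T : EuclideanSpace ℝ (Fin n) → EuclideanSpace ℝ (Fin n))
    (x : EuclideanSpace ℝ (Fin n)) : ℝ :=
  ∑ i : Fin n, fderiv ℝ T x (EuclideanSpace.single i 1) i

/-- The distributional gradient of the indicator function of `E` is the finite `ℝⁿ`-valued measure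
`σ μ`, written in polar form: `μ` is its total variation measure `|∇ 1_E|`, and `σ` is its density
with respect to `μ`, which is of unit length `μ`-almost everywhere. -/
structure IsPolarGradient {n : ℕ} (E : Set (EuclideanSpace ℝ (Fin n)))
    (μ : Measure (EuclideanSpace ℝ (Fin n)))
    (σ : EuclideanSpace ℝ (Fin n) → EuclideanSpace ℝ (Fin n)) : Prop where
  isFiniteMeasure : IsFiniteMeasure μ
  measurable : Measurable σ
  norm_eq_one : ∀ᵐ x ∂μ, ‖σ x‖ = 1
  integral_divergence : ∀ T : EuclideanSpace ℝ (Fin n) → EuclideanSpace ℝ (Fin n),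
    ContDiff ℝ 1 T → HasCompactSupport T →
      ∫ x in E, divergence T x = - ∫ x, inner ℝ (T x) (σ x) ∂μ

/-- A Lebesgue measurable set is of finite perimeter if the distributional gradient of its
indicator function is a finite measure. (The set itself may have infinite volume.) -/
def IsFinitePerimeter {n : ℕ} (E : Set (EuclideanSpace ℝ (Fin n))) : Prop :=
  NullMeasurableSet E volume ∧ ∃ μ σ, IsPolarGradient E μ σ

/-- De Giorgi's reduced boundary `∂*E`: the points `x` of the support of `|∇ 1_E|` at which
`∇ 1_E (B_r(x)) / |∇ 1_E| (B_r(x))` converges to a unit vector (the inner normal) as `r → 0`.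
The measure `∇ 1_E`, hence the pair `μ`, `σ` up to a `μ`-null set, is determined by `E`. -/
def reducedBoundary {n : ℕ} (E : Set (EuclideanSpace ℝ (Fin n))) :
    Set (EuclideanSpace ℝ (Fin n)) :=
  {x | ∃ μ σ, IsPolarGradient E μ σ ∧ (∀ r : ℝ, 0 < r → 0 < μ (Metric.ball x r)) ∧
    ∃ ν : EuclideanSpace ℝ (Fin n), ‖ν‖ = 1 ∧
      Tendsto (fun r : ℝ => ⨍ y in Metric.ball x r, σ y ∂μ) (𝓝[>] 0) (𝓝 ν)}

/-- The density `γ_n` of the standard Gaussian on `ℝⁿ`. -/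
def gaussianDensity {n : ℕ} (x : EuclideanSpace ℝ (Fin n)) : ℝ :=
  (2 * Real.pi) ^ (-(n : ℝ) / 2) * Real.exp (-‖x‖ ^ 2 / 2)

/-- The rescaled Gaussian `γ_{n,ε}(x) = ε⁻ⁿ γ_n(x/ε)`. -/
def scaledGaussian {n : ℕ} (ε : ℝ) (x : EuclideanSpace ℝ (Fin n)) : ℝ :=
  1 / ε ^ n * gaussianDensity (ε⁻¹ • x)

/-- The mollification `φ_ε = 1_E * γ_{n,ε}`. -/
def mollifiedIndicator {n : ℕ} (E : Set (EuclideanSpace ℝ (Fin n))) (ε : ℝ) :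
    EuclideanSpace ℝ (Fin n) → ℝ :=
  convolution (E.indicator fun _ => (1 : ℝ)) (scaledGaussian ε)
    (ContinuousLinearMap.mul ℝ ℝ) volume

/-- The local `H^{1/2}` energy
`∫_{B} ∫_{B} |u(x) - u(y)|² / |x - y|^{n+1} dx dy` of `u` over a set `B`, with values in
`[0, ∞]`. -/
def halfEnergy {n : ℕ} (u : EuclideanSpace ℝ (Fin n) → ℝ)
    (B : Set (EuclideanSpace ℝ (Fin n))) : ℝ≥0∞ :=
  ∫⁻ y in B, ∫⁻ x in B, ENNReal.ofReal (|u x - u y| ^ 2 / ‖x - y‖ ^ (n + 1))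

end

/-! The energy gains a fixed multiple of the boundary area from each geometric scale between `ε` and
a fixed length. There are about `|log ε|` such scales, which gives the logarithm. No blow-up,
rectifiability or structure theorem for the reduced boundary is needed.

Density. Around each reduced boundary point, `E` and its complement each have volume at least `δ
r^n` in all small balls of radius `r`, with `δ` depending only on `n`
(`exists_reducedBoundary_density`). Near such a point `∇1_E` is controlled by its component along
one direction `ν`, so a cutoff of `1_E` has variation at most `C / (r - ρ)` times the volume of `E`
in the ball. An averaged translation inequality, in place of the isoperimetric one, makes this a De
Giorgi iteration: too small a density would force `E` to be null in a smaller ball, and then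
`|∇1_E|` would vanish near the centre.

One scale. Take a Vitali family of disjoint balls of radius `s` centred on the boundary; their
number times `s^(n-1)` controls the Hausdorff measure. Each ball carries at least `δ² s^(2n)` of
pairs in `E × Eᶜ`. Discarding pairs closer than `a s` loses at most half, and the kernel is at least
`(2s)^(-n-1)` on the rest, so a ball contributes about `s^(n-1)`. Replacing `1_E` by `φ_ε` costs `C
ε / s` in total, because `‖1_E - φ_ε‖` in `L¹` is at most `C |∇1_E|(ℝⁿ) ε`
(`band_energy_lower_bound`).

All scales. For `s_j = q^j s` with `a = 2q`, the distance bands `[2q s_j, 2 s_j)` are disjoint, so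
their energies add. The errors form a geometric sum that stays bounded while `ε ≤ q^J`. Dividing by
`|log ε|` removes them. The radius below which the density bound holds varies with the point; an
increasing exhaustion of the boundary handles this without changing the constant. -/

namespace IsPolarGradient

/-! ### The distributional gradient: scalar test functions and complements. -/

variable {n : ℕ} {E : Set (EuclideanSpace ℝ (Fin n))} {μ : Measure (EuclideanSpace ℝ (Fin n))}
  {σ : EuclideanSpace ℝ (Fin n) → EuclideanSpace ℝ (Fin n)}

lemma integral_fderiv (h : IsPolarGradient E μ σ) {f : EuclideanSpace ℝ (Fin n) → ℝ}
    (hf : ContDiff ℝ 1 f) (hc : HasCompactSupport f) (w : EuclideanSpace ℝ (Fin n)) :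
    ∫ x in E, fderiv ℝ f x w = - ∫ x, f x * inner ℝ w (σ x) ∂μ := by
  have hdiv : ∀ x, divergence (fun x => f x • w) x = fderiv ℝ f x w := by
    intro x
    have hfd : DifferentiableAt ℝ f x := (hf.differentiable one_ne_zero) x
    have h1 : fderiv ℝ (fun x => f x • w) x = (fderiv ℝ f x).smulRight w :=
      (hfd.hasFDerivAt.smul_const w).fderiv
    simp only [divergence, h1, ContinuousLinearMap.smulRight_apply, PiLp.smul_apply, smul_eq_mul]
    conv_rhs => rw [← (EuclideanSpace.basisFun (Fin n) ℝ).sum_repr w]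
    simp [map_sum, mul_comm]
  have := h.integral_divergence (fun x => f x • w) (hf.smul contDiff_const) (hc.smul_right)
  simp only [hdiv, real_inner_smul_left] at this
  exact this

lemma compl (h : IsPolarGradient E μ σ) (hE : NullMeasurableSet E volume) :
    IsPolarGradient Eᶜ μ (fun x => -σ x) where
  isFiniteMeasure := h.isFiniteMeasure
  measurable := h.measurable.neg
  norm_eq_one := by simpa using h.norm_eq_one
  integral_divergence T hT hc := by
    have hfd : Continuous (fun x => fderiv ℝ T x) := hT.continuous_fderiv one_ne_zero
    have hfc : HasCompactSupport (fun x => fderiv ℝ T x) := hc.fderiv ℝ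
    have hint : ∀ i : Fin n, Integrable
        (fun x => fderiv ℝ T x (EuclideanSpace.single i 1) i) volume := by
      intro i
      refine Continuous.integrable_of_hasCompactSupport (by fun_prop) ?_
      exact hfc.comp_left (g := fun L : _ →L[ℝ] EuclideanSpace ℝ (Fin n) =>
        L (EuclideanSpace.single i 1) i) (by simp)
    have hdint : Integrable (divergence T) volume := integrable_finsetSum _ fun i _ => hint i
    have hzero : ∫ x, divergence T x = 0 := by
      unfold divergence
      rw [integral_finsetSum _ fun i _ => hint i]
      refine Finset.sum_eq_zero fun i _ => ?_
      have hTi : ContDiff ℝ 1 (fun x => T x i) := by fun_prop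
      have hci : HasCompactSupport (fun x => T x i) :=
        hc.comp_left (g := fun y : EuclideanSpace ℝ (Fin n) => y i) (by simp)
      have hder : ∀ x, fderiv ℝ (fun x => T x i) x (EuclideanSpace.single i 1) =
          fderiv ℝ T x (EuclideanSpace.single i 1) i := by
        intro x
        have h1 : HasFDerivAt T (fderiv ℝ T x) x := (hT.differentiable one_ne_zero x).hasFDerivAt
        have h2 :=
          (EuclideanSpace.proj (𝕜 := ℝ) i : EuclideanSpace ℝ (Fin n) →L[ℝ] ℝ).hasFDerivAt.comp x h1
        have h3 : fderiv ℝ (fun x => T x i) x = _ := h2.fderiv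
        rw [h3]; rfl
      -- Integration by parts against the constant function `1` shows that each partial derivative
      -- has integral zero.
      have h0 := integral_mul_fderiv_eq_neg_fderiv_mul_of_integrable (μ := volume)
        (f := fun _ : EuclideanSpace ℝ (Fin n) => (1 : ℝ)) (g := fun x => T x i)
        (v := EuclideanSpace.single i 1) (by simp) (by simpa [hder] using hint i)
        (by simpa using hTi.continuous.integrable_of_hasCompactSupport hci)
        (by simp) (fun x _ => hTi.differentiable one_ne_zero x)
      simpa [hder] using h0
    have hadd := integral_add_compl₀ hE hdint
    rw [hzero, h.integral_divergence T hT hc] at hadd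
    simp only [inner_neg_right, integral_neg]
    linarith

end IsPolarGradient

/-! ### `L¹` continuity of translations for functions of bounded variation. -/

section Translation

variable {V : Type*} [NormedAddCommGroup V] [InnerProductSpace ℝ V] [FiniteDimensional ℝ V]
  [MeasurableSpace V] [BorelSpace V]

/-- The weak formulation of `|∇ v| (V) ≤ K`. -/
def HasVariationBound (v : V → ℝ) (K : ℝ) : Prop :=
  ∀ f : V → ℝ, ContDiff ℝ 1 f → HasCompactSupport f → (∀ x, |f x| ≤ 1) →
    ∀ w : V, |∫ x, v x * fderiv ℝ f x w| ≤ K * ‖w‖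

namespace HasVariationBound

/-- The correlation `F z = ∫ v(y) g(y - z) dy` is `C¹`, and its derivative in direction `w` is `v`
tested against a derivative of a translate of `g`. Hence `‖DF‖ ≤ K`, and the mean value inequality
bounds `F h - F 0`. -/
lemma abs_integral_translate_mul_le {v : V → ℝ} {K : ℝ} (hK : HasVariationBound v K)
    (hK0 : 0 ≤ K) (hv : Measurable v) (hv1 : ∀ x, |v x| ≤ 1) (h : V) {g : V → ℝ}
    (hg : ContDiff ℝ 1 g) (hc : HasCompactSupport g) (hg1 : ∀ x, |g x| ≤ 1) :
    |∫ x, (v (x + h) - v x) * g x| ≤ K * ‖h‖ := by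
  have hvloc : LocallyIntegrable v volume :=
    (locallyIntegrable_const (1 : ℝ)).mono hv.aestronglyMeasurable
      (Eventually.of_forall (by simpa using hv1))
  -- The reflection turns the correlation into a convolution, whose derivative formula is available.
  set g' : V → ℝ := fun x => g (-x) with hg'
  have hg'd : ContDiff ℝ 1 g' := hg.comp contDiff_neg
  have hg'c : HasCompactSupport g' := hc.comp_homeomorph (Homeomorph.neg V)
  set F : V → ℝ := convolution v g' (ContinuousLinearMap.mul ℝ ℝ) volume with hF
  have hFder := fun z => hg'c.hasFDerivAt_convolution_right (ContinuousLinearMap.mul ℝ ℝ)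
    hvloc hg'd z
  have hbound : ∀ z ∈ (univ : Set V),
      ‖convolution v (fderiv ℝ g') ((ContinuousLinearMap.mul ℝ ℝ).precompR V) volume z‖ ≤ K := by
    intro z _
    refine ContinuousLinearMap.opNorm_le_bound _ hK0 fun w => ?_
    rw [convolution_precompR_apply _ hvloc (hg'c.fderiv ℝ) (hg'd.continuous_fderiv one_ne_zero)]
    simp only [convolution, ContinuousLinearMap.mul_apply', Real.norm_eq_abs]
    have hfd : ContDiff ℝ 1 (fun y => g' (z - y)) := hg'd.comp (contDiff_const.sub contDiff_id)
    have hfc : HasCompactSupport (fun y => g' (z - y)) :=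
      hg'c.comp_homeomorph (Homeomorph.subLeft z)
    have key := hK _ hfd hfc (fun x => hg1 _) w
    have hder : ∀ y, fderiv ℝ (fun y => g' (z - y)) y w = - fderiv ℝ g' (z - y) w := by
      intro y
      have h1 : HasFDerivAt g' (fderiv ℝ g' (z - y)) (z - y) :=
        (hg'd.differentiable one_ne_zero _).hasFDerivAt
      have h2 : HasFDerivAt (fun y => z - y) (-ContinuousLinearMap.id ℝ V) y := by
        simpa using (hasFDerivAt_id y).const_sub z
      have h3 : fderiv ℝ (fun y => g' (z - y)) y = _ := (h1.comp y h2).fderiv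
      rw [h3]
      simp
    simpa [hder, integral_neg] using key
  have hmv := convex_univ.norm_image_sub_le_of_norm_hasFDerivWithin_le
    (fun x _ => (hFder x).hasFDerivWithinAt) hbound (mem_univ 0) (mem_univ h)
  have hFint : ∀ z, Integrable (fun y => v y * g (y - z)) volume := by
    intro z
    have hgz : Integrable (fun y => g (y - z)) volume :=
      (hg.continuous.integrable_of_hasCompactSupport hc).comp_sub_right z
    exact hgz.bdd_mul hv.aestronglyMeasurable (Eventually.of_forall (by simpa using hv1))
  have hF' : ∀ z, F z = ∫ y, v y * g (y - z) := by
    intro z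
    simp [hF, convolution, hg']
  have hshift : ∫ x, v (x + h) * g x = F h := by
    rw [hF', ← integral_add_right_eq_self (fun y => v y * g (y - h)) h]
    simp
  have hI1 : Integrable (fun x => v (x + h) * g x) volume := by
    simpa using (hFint h).comp_add_right h
  have hI0 : Integrable (fun x => v x * g x) volume := by simpa using hFint 0
  have : ∫ x, (v (x + h) - v x) * g x = F h - F 0 := by
    simp_rw [sub_mul]
    rw [integral_sub hI1 hI0, hshift, hF' 0]
    simp
  rw [this]
  simpa using hmv

/-- Duality: the `L¹` norm on a ball is the pairing of `v(· + h) - v` with its own sign. Mollified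
signs are admissible test functions, and they converge almost everywhere. -/
lemma lintegral_translate_le {v : V → ℝ} {K : ℝ} (hK : HasVariationBound v K)
    (hK0 : 0 ≤ K) (hv : Measurable v) (hv1 : ∀ x, |v x| ≤ 1) (h : V) :
    ∫⁻ x, ENNReal.ofReal |v (x + h) - v x| ≤ ENNReal.ofReal (K * ‖h‖) := by
  set d : V → ℝ := fun x => v (x + h) - v x with hd
  have hdm : Measurable d := (hv.comp (measurable_id.add_const h)).sub hv
  have hd2 : ∀ x, |d x| ≤ 2 := fun x => by
    have := abs_sub (v (x + h)) (v x)
    have := hv1 x; have := hv1 (x + h)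
    simp only [hd]; linarith
  have hball : ∀ R : ℕ, ∫⁻ x in Metric.ball (0 : V) R, ENNReal.ofReal |d x| ≤
      ENNReal.ofReal (K * ‖h‖) := by
    intro R
    set s : V → ℝ := (Metric.ball (0 : V) R).indicator (fun x => (SignType.sign (d x) : ℝ)) with hs
    have hsm : Measurable s := by
      have h1 : Measurable (fun x => (SignType.sign (d x) : ℝ)) := by
        have : (fun x => (SignType.sign (d x) : ℝ)) =
            fun x => if 0 < d x then (1 : ℝ) else if d x < 0 then -1 else 0 := by
          ext x
          rcases lt_trichotomy (d x) 0 with h | h | h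
          · simp [h, h.not_gt]
          · simp [h]
          · simp [h]
        rw [this]
        exact Measurable.ite (measurableSet_lt measurable_const hdm) measurable_const
          (Measurable.ite (measurableSet_lt hdm measurable_const) measurable_const measurable_const)
      exact h1.indicator measurableSet_ball
    have hs1 : ∀ x, |s x| ≤ 1 := by
      intro x
      by_cases hx : x ∈ Metric.ball (0 : V) R
      · simp only [hs, indicator_of_mem hx]
        rcases lt_trichotomy (d x) 0 with h | h | h <;> simp [h]
      · simp [hs, indicator_of_notMem hx]
    have hss : Function.support s ⊆ Metric.ball (0 : V) R := support_indicator_subset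
    have hsloc : LocallyIntegrable s volume :=
      (locallyIntegrable_const (1 : ℝ)).mono hsm.aestronglyMeasurable
        (Eventually.of_forall (by simpa using hs1))
    have hsc : HasCompactSupport s :=
      HasCompactSupport.of_support_subset_isCompact (isCompact_closedBall (0 : V) R)
        (hss.trans Metric.ball_subset_closedBall)
    -- The bounded ratio `rOut / rIn = 2` is what the Lebesgue differentiation argument for almost
    -- everywhere convergence requires.
    set φ : ℕ → ContDiffBump (0 : V) := fun k =>
      ⟨1 / (2 * ((k : ℝ) + 1)), 1 / ((k : ℝ) + 1), by positivity, by
        gcongr; linarith [show (0:ℝ) ≤ k from k.cast_nonneg]⟩ with hφ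
    have hφ0 : Tendsto (fun k => (φ k).rOut) atTop (𝓝 0) := tendsto_one_div_add_atTop_nhds_zero_nat
    have hφ1 : ∀ k, (φ k).rOut ≤ 2 * (φ k).rIn := fun k => by
      simp only [hφ]
      apply le_of_eq
      field_simp
    have hae := ContDiffBump.ae_convolution_tendsto_right_of_locallyIntegrable (K := 2) (μ := volume)
      hφ0 (Eventually.of_forall hφ1) hsloc
    set g : ℕ → V → ℝ := fun k =>
      convolution ((φ k).normed volume) s (ContinuousLinearMap.lsmul ℝ ℝ) volume with hg
    have hgd : ∀ k, ContDiff ℝ 1 (g k) := fun k =>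
      (φ k).hasCompactSupport_normed.contDiff_convolution_left _ (φ k).contDiff_normed hsloc
    have hgc : ∀ k, HasCompactSupport (g k) := fun k =>
      (φ k).hasCompactSupport_normed.convolution _ hsc
    have hg1 : ∀ k x, |g k x| ≤ 1 := by
      intro k x
      simp only [hg, convolution, ContinuousLinearMap.lsmul_apply, smul_eq_mul]
      calc |∫ t, (φ k).normed volume t * s (x - t)|
          ≤ ∫ t, |(φ k).normed volume t * s (x - t)| := abs_integral_le_integral_abs
        _ ≤ ∫ t, (φ k).normed volume t := by
            refine integral_mono_of_nonneg (Eventually.of_forall fun _ => abs_nonneg _)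
              (φ k).integrable_normed (Eventually.of_forall fun t => ?_)
            simp only [abs_mul, abs_of_nonneg ((φ k).nonneg_normed t)]
            exact mul_le_of_le_one_right ((φ k).nonneg_normed t) (hs1 _)
        _ = 1 := (φ k).integral_normed
    -- A common support for all mollified signs provides the dominating function below.
    have hgs : ∀ k x, x ∉ Metric.closedBall (0 : V) (R + 1) → g k x = 0 := by
      intro k x hx
      by_contra hne
      have hsup := support_convolution_subset (L := ContinuousLinearMap.lsmul ℝ ℝ)
        (f := (φ k).normed volume) (g := s) (μ := volume) (Function.mem_support.2 hne)
      obtain ⟨a, ha, b, hb, rfl⟩ := hsup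
      rw [(φ k).support_normed_eq] at ha
      have hb' := hss hb
      simp only [mem_ball_zero_iff, Metric.mem_closedBall, dist_zero_right] at ha hb' hx
      have h1 : (φ k).rOut ≤ 1 := by
        simp only [hφ]
        rw [div_le_one (by positivity)]
        linarith [show (0:ℝ) ≤ k from k.cast_nonneg]
      exact hx ((norm_add_le a b).trans (by linarith))
    have hlim : Tendsto (fun k => ∫ x, d x * g k x) atTop (𝓝 (∫ x, d x * s x)) := by
      refine tendsto_integral_of_dominated_convergence
        ((Metric.closedBall (0 : V) (R + 1)).indicator fun _ => (2 : ℝ)) ?_ ?_ ?_ ?_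
      · exact fun k => (hdm.mul (hgd k).continuous.measurable).aestronglyMeasurable
      · exact (integrable_indicator_iff measurableSet_closedBall).2
          (integrableOn_const (measure_closedBall_lt_top.ne))
      · intro k
        refine Eventually.of_forall fun x => ?_
        by_cases hx : x ∈ Metric.closedBall (0 : V) (R + 1)
        · rw [indicator_of_mem hx, Real.norm_eq_abs, abs_mul]
          calc |d x| * |g k x| ≤ 2 * 1 := by gcongr; exacts [hd2 x, hg1 k x]
            _ = 2 := by norm_num
        · rw [indicator_of_notMem hx, hgs k x hx]; simp
      · filter_upwards [hae] with x hx
        exact hx.const_mul _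
    have hle : ∫ x, d x * s x ≤ K * ‖h‖ :=
      le_of_tendsto' hlim fun k => (le_abs_self _).trans
        (hK.abs_integral_translate_mul_le hK0 hv hv1 h (hgd k) (hgc k) (hg1 k))
    have heq : ∫ x, d x * s x = ∫ x in Metric.ball (0 : V) R, |d x| := by
      rw [← integral_indicator measurableSet_ball]
      congr 1; ext x
      by_cases hx : x ∈ Metric.ball (0 : V) R
      · simp only [hs, indicator_of_mem hx]
        exact self_mul_sign (d x)
      · simp [hs, indicator_of_notMem hx]
    rw [heq] at hle
    rw [← ofReal_integral_eq_lintegral_ofReal]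
    · exact ENNReal.ofReal_le_ofReal hle
    · refine Integrable.mono' (g := fun _ => (2 : ℝ)) (integrableOn_const (measure_ball_lt_top.ne))
        hdm.abs.aestronglyMeasurable (Eventually.of_forall fun x => by simpa using hd2 x)
    · exact Eventually.of_forall fun _ => abs_nonneg _
  have hU : (⋃ R : ℕ, Metric.ball (0 : V) R) = univ := Metric.iUnion_ball_nat 0
  rw [← setLIntegral_univ, ← hU, setLIntegral_iUnion_of_directed]
  · exact iSup_le hball
  · exact (directed_of_isDirected_le fun i j hij => Metric.ball_subset_ball (by exact_mod_cast hij))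

end HasVariationBound

end Translation

/-! ### Radial cutoffs and the layer-cake formula. -/

lemma Real.exists_abs_deriv_smoothTransition_le :
    ∃ L : ℝ, 0 < L ∧ ∀ x, |deriv Real.smoothTransition x| ≤ L := by
  have hc : Continuous (deriv Real.smoothTransition) :=
    (Real.smoothTransition.contDiff (n := 1)).continuous_deriv le_rfl
  obtain ⟨C, hC⟩ := (isCompact_Icc (a := (0 : ℝ)) (b := 1)).exists_bound_of_continuousOn
    hc.continuousOn
  refine ⟨max C 1, by positivity, fun x => ?_⟩
  by_cases hx : x ∈ Icc (0 : ℝ) 1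
  · exact (hC x hx).trans (le_max_left _ _)
  · have hzero : deriv Real.smoothTransition x = 0 := by
      rcases not_and_or.1 hx with h | h
      · have : Real.smoothTransition =ᶠ[𝓝 x] fun _ => 0 := by
          filter_upwards [Iio_mem_nhds (not_le.1 h)] with y hy
          exact Real.smoothTransition.zero_of_nonpos (le_of_lt hy)
        rw [this.deriv_eq]; simp
      · have : Real.smoothTransition =ᶠ[𝓝 x] fun _ => 1 := by
          filter_upwards [Ioi_mem_nhds (not_le.1 h)] with y hy
          exact Real.smoothTransition.one_of_one_le (le_of_lt hy)
        rw [this.deriv_eq]; simp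
    rw [hzero]; simp

section Cutoff

variable {V : Type*} [NormedAddCommGroup V] [InnerProductSpace ℝ V]

/-- A radially nonincreasing `C¹` function which is `1` on `B_ρ(c)`, vanishes outside `B_r(c)`, and
has gradient bounded by `K / (r - ρ)`. -/
structure IsRadialCutoff (c : V) (ρ r K : ℝ) (χ : V → ℝ) : Prop where
  contDiff : ContDiff ℝ 1 χ
  nonneg : ∀ x, 0 ≤ χ x
  le_one : ∀ x, χ x ≤ 1
  eq_one : ∀ x ∈ Metric.ball c ρ, χ x = 1
  eq_zero : ∀ x ∉ Metric.ball c r, χ x = 0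
  norm_fderiv_le : ∀ x, ‖fderiv ℝ χ x‖ ≤ K / (r - ρ)
  superlevel : ∀ t : ℝ, 0 ≤ t → ∃ s ≤ r, {x | t < χ x} = Metric.ball c s

namespace IsRadialCutoff

variable {c : V} {ρ r K : ℝ} {χ : V → ℝ}

lemma fderiv_eq_zero (h : IsRadialCutoff c ρ r K χ) {x : V} (hx : x ∉ Metric.ball c r) :
    fderiv ℝ χ x = 0 := by
  refine IsLocalMin.fderiv_eq_zero (Eventually.of_forall fun y => ?_)
  rw [h.eq_zero x hx]
  exact h.nonneg y

lemma hasCompactSupport [FiniteDimensional ℝ V] (h : IsRadialCutoff c ρ r K χ) : HasCompactSupport χ := by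
  refine HasCompactSupport.of_support_subset_isCompact (isCompact_closedBall c r) fun x hx => ?_
  by_contra hx'
  exact hx (h.eq_zero x fun h' => hx' (Metric.ball_subset_closedBall h'))

lemma abs_fderiv_apply_le (h : IsRadialCutoff c ρ r K χ) (x w : V) :
    |fderiv ℝ χ x w| ≤ (Metric.ball c r).indicator (fun _ => K / (r - ρ) * ‖w‖) x := by
  by_cases hx : x ∈ Metric.ball c r
  · rw [indicator_of_mem hx]
    exact ((fderiv ℝ χ x).le_opNorm w).trans (by gcongr; exact h.norm_fderiv_le x)
  · rw [indicator_of_notMem hx, h.fderiv_eq_zero hx]; simp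

end IsRadialCutoff

lemma exists_isRadialCutoff : ∃ K : ℝ, 0 < K ∧ ∀ (V : Type) [NormedAddCommGroup V]
    [InnerProductSpace ℝ V] (c : V) (ρ r : ℝ), 0 < ρ → ρ < r →
      ∃ χ, IsRadialCutoff c ρ r K χ := by
  obtain ⟨L, hL0, hL⟩ := Real.exists_abs_deriv_smoothTransition_le
  refine ⟨2 * L, by positivity, fun V _ _ c ρ r hρ hr => ?_⟩
  have hden : 0 < r ^ 2 - ρ ^ 2 := by nlinarith
  set ψ : ℝ → ℝ := fun s => Real.smoothTransition ((r ^ 2 - s ^ 2) / (r ^ 2 - ρ ^ 2)) with hψ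
  -- The squared norm keeps the cutoff differentiable at the centre; the gradient is then at most `2
  -- L r / (r² - ρ²) ≤ 2 L / (r - ρ)`.
  set χ : V → ℝ := fun x =>
    Real.smoothTransition ((r ^ 2 - ‖x - c‖ ^ 2) / (r ^ 2 - ρ ^ 2)) with hχ
  have hd : ContDiff ℝ 1 χ := Real.smoothTransition.contDiff.comp
    ((contDiff_const.sub ((contDiff_id.sub contDiff_const).norm_sq ℝ)).div_const _)
  have hzero : ∀ x ∉ Metric.ball c r, χ x = 0 := by
    intro x hx
    rw [mem_ball_iff_norm, not_lt] at hx
    refine Real.smoothTransition.zero_of_nonpos (div_nonpos_of_nonpos_of_nonneg ?_ hden.le)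
    nlinarith
  refine ⟨χ, hd, fun x => Real.smoothTransition.nonneg _, fun x => Real.smoothTransition.le_one _,
    ?_, hzero, ?_, ?_⟩
  · intro x hx
    rw [mem_ball_iff_norm] at hx
    refine Real.smoothTransition.one_of_one_le ((one_le_div hden).2 ?_)
    nlinarith [norm_nonneg (x - c)]
  · intro x
    by_cases hx : x ∈ Metric.ball c r
    · rw [mem_ball_iff_norm] at hx
      have h1 : HasFDerivAt (fun x : V => ‖x - c‖ ^ 2) (2 • innerSL ℝ (x - c)) x := by
        simpa using ((hasFDerivAt_id x).sub_const c).norm_sq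
      have h2 := (((h1.const_sub (r ^ 2)).mul_const (r ^ 2 - ρ ^ 2)⁻¹))
      have h3 : HasDerivAt Real.smoothTransition _ ((r ^ 2 - ‖x - c‖ ^ 2) * (r ^ 2 - ρ ^ 2)⁻¹) :=
        ((Real.smoothTransition.contDiff (n := 1)).differentiable one_ne_zero _).hasDerivAt
      have h4 : χ = Real.smoothTransition ∘
          fun y => (r ^ 2 - ‖y - c‖ ^ 2) * (r ^ 2 - ρ ^ 2)⁻¹ := by
        ext y; simp [hχ, div_eq_mul_inv]
      rw [h4, (h3.comp_hasFDerivAt x h2).fderiv]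
      refine ContinuousLinearMap.opNorm_le_bound _ (div_nonneg (by positivity) (by linarith))
        fun w => ?_
      simp only [smul_apply, neg_apply, smul_eq_mul,
        nsmul_eq_mul, innerSL_apply_apply, Real.norm_eq_abs, abs_mul, abs_neg, abs_inv,
        abs_of_pos hden]
      have hin : |inner ℝ (x - c) w| ≤ r * ‖w‖ :=
        (abs_real_inner_le_norm _ _).trans (by gcongr)
      have hq : (r ^ 2 - ρ ^ 2)⁻¹ * r ≤ 1 / (r - ρ) := by
        rw [inv_mul_le_iff₀ hden, mul_one_div, le_div_iff₀ (by linarith)]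
        nlinarith
      calc _ ≤ L * ((r ^ 2 - ρ ^ 2)⁻¹ * (2 * (r * ‖w‖))) := by
            gcongr
            · exact hL _
            · simp
        _ = 2 * L * ((r ^ 2 - ρ ^ 2)⁻¹ * r) * ‖w‖ := by ring
        _ ≤ 2 * L * (1 / (r - ρ)) * ‖w‖ := by gcongr
        _ = _ := by ring
    · rw [IsLocalMin.fderiv_eq_zero (Eventually.of_forall fun y => ?_)]
      · simpa using div_nonneg (by positivity) (by linarith : (0 : ℝ) ≤ r - ρ)
      · rw [hzero x hx]
        exact Real.smoothTransition.nonneg _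
  · intro t ht
    have hψc : Continuous ψ := Real.smoothTransition.continuous.comp (by fun_prop)
    -- The radius of the superlevel ball is the first radius at which the profile drops to `t`.
    set A : Set ℝ := {s | 0 ≤ s ∧ ψ s ≤ t} with hA
    have hrA : r ∈ A := ⟨by linarith, by simpa [hψ] using ht⟩
    have hAc : IsClosed A := isClosed_Ici.inter (isClosed_le hψc continuous_const)
    have hAb : BddBelow A := ⟨0, fun s hs => hs.1⟩
    have hmem : sInf A ∈ A := hAc.csInf_mem ⟨r, hrA⟩ hAb
    refine ⟨sInf A, csInf_le hAb hrA, ?_⟩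
    ext x
    rw [mem_ball_iff_norm]
    constructor
    · intro hx
      by_contra hlt
      have hle : ψ ‖x - c‖ ≤ ψ (sInf A) := by
        refine Real.smoothTransition.monotone ?_
        have := hmem.1
        rw [not_lt] at hlt
        gcongr
      exact absurd (hle.trans hmem.2) (not_le.2 hx)
    · intro hx
      by_contra hle
      exact absurd (csInf_le hAb ⟨norm_nonneg _, not_lt.1 hle⟩) (not_le.2 hx)

namespace IsRadialCutoff

variable {V : Type*} [NormedAddCommGroup V] [InnerProductSpace ℝ V] [FiniteDimensional ℝ V]
  [MeasurableSpace V] [BorelSpace V] {c : V} {ρ r K : ℝ} {χ : V → ℝ}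

/-- Layer cake: `χ` is an average over `t` of indicators of its superlevel sets, which are
concentric balls. This passes from the balls in the definition of the reduced boundary to smooth
test functions. -/
lemma integral_mul_nonneg (h : IsRadialCutoff c ρ r K χ) {μ : Measure V} [IsFiniteMeasure μ]
    {k : V → ℝ} (hk : Integrable k μ)
    (hball : ∀ s, 0 < s → s ≤ r → 0 ≤ ∫ x in Metric.ball c s, k x ∂μ) :
    0 ≤ ∫ x, χ x * k x ∂μ := by
  have hmeas : MeasurableSet {p : V × ℝ | p.2 < χ p.1} :=
    measurableSet_lt measurable_snd (h.contDiff.continuous.measurable.comp measurable_fst)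
  have hint : Integrable (Function.uncurry fun (x : V) (t : ℝ) =>
      {p : V × ℝ | p.2 < χ p.1}.indicator (fun p => k p.1) (x, t))
      (μ.prod (volume.restrict (Ioc (0 : ℝ) 1))) := by
    have : (Function.uncurry fun (x : V) (t : ℝ) =>
      {p : V × ℝ | p.2 < χ p.1}.indicator (fun p => k p.1) (x, t)) =
      {p : V × ℝ | p.2 < χ p.1}.indicator (fun p => k p.1) := by ext ⟨x, t⟩; rfl
    rw [this]
    exact (hk.comp_fst _).indicator hmeas
  have hinner : ∀ x, ∫ t in Ioc (0 : ℝ) 1,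
      {p : V × ℝ | p.2 < χ p.1}.indicator (fun p => k p.1) (x, t) = χ x * k x := by
    intro x
    have h1 : (fun t : ℝ => {p : V × ℝ | p.2 < χ p.1}.indicator (fun p => k p.1) (x, t)) =
        (Iio (χ x)).indicator fun _ => k x := by
      ext t; simp [indicator]
    rw [h1, integral_indicator measurableSet_Iio, setIntegral_const,
      measureReal_restrict_apply measurableSet_Iio, smul_eq_mul]
    congr 1
    rcases (h.le_one x).eq_or_lt with h1 | h1
    · have : Iio (χ x) ∩ Ioc (0 : ℝ) 1 = Ioo 0 1 := by
        rw [h1]; ext t; simp only [mem_inter_iff, mem_Iio, mem_Ioc, mem_Ioo]; grind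
      rw [this, h1]; simp
    · have : Iio (χ x) ∩ Ioc (0 : ℝ) 1 = Ioo 0 (χ x) := by
        ext t; simp only [mem_inter_iff, mem_Iio, mem_Ioc, mem_Ioo]; grind
      rw [this]; simp [h.nonneg x]
  calc (0 : ℝ) ≤ ∫ t in Ioc (0 : ℝ) 1, ∫ x,
        {p : V × ℝ | p.2 < χ p.1}.indicator (fun p => k p.1) (x, t) ∂μ := by
        refine setIntegral_nonneg measurableSet_Ioc fun t ht => ?_
        obtain ⟨s, hs, hst⟩ := h.superlevel t ht.1.le
        have h1 : (fun x : V => {p : V × ℝ | p.2 < χ p.1}.indicator (fun p => k p.1) (x, t)) =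
            (Metric.ball c s).indicator k := by
          rw [← hst]; ext x; simp [indicator]
        rw [h1, integral_indicator measurableSet_ball]
        rcases le_or_gt s 0 with h0 | h0
        · simp [Metric.ball_eq_empty.2 h0]
        · exact hball s h0 hs
    _ = ∫ x, χ x * k x ∂μ := by
        rw [← integral_integral_swap hint]
        exact integral_congr_ae (Eventually.of_forall hinner)

end IsRadialCutoff

end Cutoff

/-! ### De Giorgi iteration and lower density bounds. -/

/-- Along the radii `R/2 (1 + 2^(-k))`, whose gaps are `R 2^(-k) / 4`, take `t = θ R 2^(-k)`. Each
step multiplies `m` by at most `4 C θ ≤ 2^(-n)`, which is exactly the decay needed to preserve `m ≤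
t^n`. -/
lemma degiorgi_iteration {n : ℕ} (hn : 1 ≤ n) {m : ℝ → ℝ} {C θ R : ℝ} (hC : 0 ≤ C) (hθ : 0 < θ)
    (hR : 0 < R) (hCθ : C * θ * (4 * 2 ^ n) ≤ 1) (hm : Monotone m) (hm0 : ∀ r, 0 ≤ m r)
    (hiter : ∀ t ρ r, 0 < t → 0 < ρ → ρ < r → r ≤ R → m r ≤ t ^ n → m ρ ≤ C * t / (r - ρ) * m r)
    (hRm : m R ≤ (θ * R) ^ n) : m (R / 2) = 0 := by
  have key : ∀ k : ℕ, m (R / 2 * (1 + (1 / 2) ^ k)) ≤ (θ * R * (1 / 2) ^ k) ^ n := by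
    intro k
    induction k with
    | zero =>
      have : R / 2 * (1 + 1) = R := by ring
      simpa [this] using hRm
    | succ k ih =>
      have hp : (0 : ℝ) < (1 / 2) ^ k := by positivity
      have hp1 : (1 / 2 : ℝ) ^ k ≤ 1 := pow_le_one₀ (by norm_num) (by norm_num)
      have h1 := hiter (θ * R * (1 / 2) ^ k) (R / 2 * (1 + (1 / 2) ^ (k + 1)))
        (R / 2 * (1 + (1 / 2) ^ k)) (by positivity) (by positivity)
        (by rw [pow_succ]; gcongr; linarith) (by nlinarith) ih
      have h2 : R / 2 * (1 + (1 / 2) ^ k) - R / 2 * (1 + (1 / 2) ^ (k + 1)) =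
          R * (1 / 2) ^ k / 4 := by rw [pow_succ]; ring
      rw [h2] at h1
      have h3 : C * (θ * R * (1 / 2) ^ k) / (R * (1 / 2) ^ k / 4) = C * θ * 4 := by
        field_simp
      rw [h3] at h1
      calc _ ≤ C * θ * 4 * (θ * R * (1 / 2) ^ k) ^ n := h1.trans (by gcongr)
        _ = C * θ * (4 * 2 ^ n) * (θ * R * (1 / 2) ^ (k + 1)) ^ n := by
            have : θ * R * (1 / 2) ^ k = 2 * (θ * R * (1 / 2) ^ (k + 1)) := by
              rw [pow_succ]; ring
            rw [this, mul_pow]; ring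
        _ ≤ 1 * (θ * R * (1 / 2) ^ (k + 1)) ^ n := by gcongr
        _ = _ := one_mul _
  refine le_antisymm ?_ (hm0 _)
  have hlim : Tendsto (fun k : ℕ => (θ * R * (1 / 2) ^ k) ^ n) atTop (𝓝 0) := by
    have h1 : Tendsto (fun k : ℕ => θ * R * (1 / 2 : ℝ) ^ k) atTop (𝓝 (θ * R * 0)) :=
      (tendsto_pow_atTop_nhds_zero_of_lt_one (by norm_num) (by norm_num)).const_mul _
    have h2 := h1.pow n
    rwa [mul_zero, zero_pow (by omega)] at h2
  refine ge_of_tendsto' hlim fun k => (hm ?_).trans (key k)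
  nlinarith [show (0 : ℝ) < (1 / 2) ^ k by positivity]

namespace IsPolarGradient

variable {n : ℕ} {E : Set (EuclideanSpace ℝ (Fin n))} {μ : Measure (EuclideanSpace ℝ (Fin n))}
  {σ : EuclideanSpace ℝ (Fin n) → EuclideanSpace ℝ (Fin n)}

lemma congr_ae {F : Set (EuclideanSpace ℝ (Fin n))} (h : IsPolarGradient E μ σ)
    (hEF : E =ᵐ[volume] F) : IsPolarGradient F μ σ :=
  ⟨h.isFiniteMeasure, h.measurable, h.norm_eq_one, fun T hT hc => by
    rw [← h.integral_divergence T hT hc, Measure.restrict_congr_set hEF]⟩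

lemma integrable_inner (h : IsPolarGradient E μ σ) (w : EuclideanSpace ℝ (Fin n)) :
    Integrable (fun x => inner ℝ w (σ x)) μ := by
  have := h.isFiniteMeasure
  refine Integrable.mono' (integrable_const ‖w‖)
    ((continuous_const.inner continuous_id).measurable.comp h.measurable).aestronglyMeasurable ?_
  filter_upwards [h.norm_eq_one] with x hx
  simpa [hx] using abs_real_inner_le_norm w (σ x)

lemma abs_integral_mul_inner_le (h : IsPolarGradient E μ σ) {f g : EuclideanSpace ℝ (Fin n) → ℝ}
    (hg : Integrable g μ) (hfg : ∀ x, |f x| ≤ g x) (w : EuclideanSpace ℝ (Fin n)) :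
    |∫ x, f x * inner ℝ w (σ x) ∂μ| ≤ (∫ x, g x ∂μ) * ‖w‖ := by
  rw [← Real.norm_eq_abs, ← integral_mul_const]
  refine norm_integral_le_of_norm_le (hg.mul_const _) ?_
  filter_upwards [h.norm_eq_one] with x hx
  rw [Real.norm_eq_abs, abs_mul]
  have h1 := abs_real_inner_le_norm w (σ x)
  rw [hx, mul_one] at h1
  exact mul_le_mul (hfg x) h1 (abs_nonneg _) ((abs_nonneg _).trans (hfg x))

lemma hasVariationBound_indicator_one (h : IsPolarGradient E μ σ) (hE : MeasurableSet E) :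
    HasVariationBound (E.indicator fun _ => (1 : ℝ)) (μ.real univ) := by
  have := h.isFiniteMeasure
  intro f hf hc hf1 w
  have h1 : ∀ x, E.indicator (fun _ => (1 : ℝ)) x * fderiv ℝ f x w =
      E.indicator (fun x => fderiv ℝ f x w) x := fun x => by
    by_cases hx : x ∈ E <;> simp [hx]
  simp_rw [h1]
  rw [integral_indicator hE, h.integral_fderiv hf hc, abs_neg]
  simpa using h.abs_integral_mul_inner_le (integrable_const (1 : ℝ)) hf1 w

variable {c ν : EuclideanSpace ℝ (Fin n)} {ρ r K : ℝ} {χ : EuclideanSpace ℝ (Fin n) → ℝ}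

lemma abs_setIntegral_mul_fderiv_le (E : Set (EuclideanSpace ℝ (Fin n))) (hχ : IsRadialCutoff c ρ r K χ)
    {f : EuclideanSpace ℝ (Fin n) → ℝ} (hf1 : ∀ x, |f x| ≤ 1) (w : EuclideanSpace ℝ (Fin n)) :
    |∫ x in E, f x * fderiv ℝ χ x w| ≤
      K / (r - ρ) * volume.real (E ∩ Metric.ball c r) * ‖w‖ := by
  have h1 : K / (r - ρ) * volume.real (E ∩ Metric.ball c r) * ‖w‖ =
      ∫ x in E, (Metric.ball c r).indicator (fun _ => K / (r - ρ) * ‖w‖) x := by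
    rw [integral_indicator measurableSet_ball, setIntegral_const, smul_eq_mul,
      measureReal_restrict_apply measurableSet_ball, inter_comm]
    ring
  rw [h1, ← Real.norm_eq_abs]
  refine norm_integral_le_of_norm_le ?_ (Eventually.of_forall fun x => ?_)
  · refine Integrable.integrableOn ((integrable_indicator_iff measurableSet_ball).2 ?_)
    exact integrableOn_const measure_ball_lt_top.ne
  · rw [Real.norm_eq_abs, abs_mul]
    calc |f x| * |fderiv ℝ χ x w| ≤ 1 * |fderiv ℝ χ x w| := by gcongr; exact hf1 x
      _ ≤ _ := by rw [one_mul]; exact hχ.abs_fderiv_apply_le x w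

/-- The layer cake gives `½ ∫ χ dμ ≤ ∫ χ ⟨ν, σ⟩ dμ`, and the right side equals `-∫_E ∂_ν χ`. Thus a
perimeter is bounded by a volume. -/
lemma integral_cutoff_le (h : IsPolarGradient E μ σ)
    (hχ : IsRadialCutoff c ρ r K χ) (hν : ‖ν‖ = 1)
    (hball : ∀ s, 0 < s → s ≤ r →
      1 / 2 * μ.real (Metric.ball c s) ≤ ∫ x in Metric.ball c s, inner ℝ ν (σ x) ∂μ) :
    ∫ x, χ x ∂μ ≤ 2 * (K / (r - ρ) * volume.real (E ∩ Metric.ball c r)) := by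
  have := h.isFiniteMeasure
  have hχi : Integrable χ μ := hχ.contDiff.continuous.integrable_of_hasCompactSupport
    hχ.hasCompactSupport
  have hχb : ∀ᵐ x ∂μ, ‖χ x‖ ≤ 1 := Eventually.of_forall fun x => by
    rw [Real.norm_eq_abs, abs_of_nonneg (hχ.nonneg x)]; exact hχ.le_one x
  have h1 := hχ.integral_mul_nonneg (μ := μ) (k := fun x => inner ℝ ν (σ x) - 1 / 2)
    ((h.integrable_inner ν).sub (integrable_const _)) fun s hs hsr => by
      rw [integral_sub (h.integrable_inner ν).integrableOn (integrable_const _), setIntegral_const,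
        smul_eq_mul]
      linarith [hball s hs hsr]
  simp_rw [mul_sub] at h1
  rw [integral_sub ((h.integrable_inner ν).bdd_mul hχ.contDiff.continuous.aestronglyMeasurable hχb)
    (hχi.mul_const _), integral_mul_const] at h1
  have h2 := h.integral_fderiv hχ.contDiff hχ.hasCompactSupport ν
  have h3 := abs_setIntegral_mul_fderiv_le E hχ (f := fun _ => 1) (by simp) ν
  simp only [one_mul, hν, mul_one] at h3
  have h4 := neg_abs_le (∫ x in E, fderiv ℝ χ x ν)
  linarith

/-- By the product rule the gradient of `χ 1_E` is `χ ∇1_E + 1_E ∇χ`. The first term costs `2` by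
the preceding lemma and the second costs `1`, whence the factor `3`. -/
lemma hasVariationBound_indicator_cutoff (h : IsPolarGradient E μ σ) (hE : MeasurableSet E)
    (hχ : IsRadialCutoff c ρ r K χ) (hν : ‖ν‖ = 1)
    (hball : ∀ s, 0 < s → s ≤ r →
      1 / 2 * μ.real (Metric.ball c s) ≤ ∫ x in Metric.ball c s, inner ℝ ν (σ x) ∂μ) :
    HasVariationBound (E.indicator χ) (3 * (K / (r - ρ) * volume.real (E ∩ Metric.ball c r))) := by
  have := h.isFiniteMeasure
  intro f hf hc hf1 w
  have hχi : Integrable χ μ := hχ.contDiff.continuous.integrable_of_hasCompactSupport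
    hχ.hasCompactSupport
  have h1 : ∀ x, E.indicator χ x * fderiv ℝ f x w =
      E.indicator (fun x => fderiv ℝ (fun y => χ y * f y) x w - f x * fderiv ℝ χ x w) x := by
    intro x
    by_cases hx : x ∈ E
    · simp only [indicator_of_mem hx]
      rw [fderiv_fun_mul (hχ.contDiff.differentiable one_ne_zero x)
        (hf.differentiable one_ne_zero x)]
      simp
    · simp [hx]
  simp_rw [h1]
  have hcf : Continuous (fderiv ℝ (fun y => χ y * f y)) :=
    (hχ.contDiff.mul hf).continuous_fderiv one_ne_zero
  have hcχ : Continuous (fderiv ℝ χ) := hχ.contDiff.continuous_fderiv one_ne_zero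
  have hci : Integrable (fun x => fderiv ℝ (fun y => χ y * f y) x w) volume :=
    Continuous.integrable_of_hasCompactSupport (by fun_prop)
      ((hχ.hasCompactSupport.mul_right.fderiv ℝ).comp_left
        (g := fun L : _ →L[ℝ] ℝ => L w) (by simp))
  have hci' : Integrable (fun x => f x * fderiv ℝ χ x w) volume :=
    Continuous.integrable_of_hasCompactSupport (by have := hf.continuous; fun_prop) hc.mul_right
  rw [integral_indicator hE, integral_sub hci.integrableOn hci'.integrableOn,
    h.integral_fderiv (hχ.contDiff.mul hf) hχ.hasCompactSupport.mul_right]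
  have h2 := h.abs_integral_mul_inner_le (f := fun y => χ y * f y) hχi (fun x => by
    rw [abs_mul, abs_of_nonneg (hχ.nonneg x)]
    exact mul_le_of_le_one_right (hχ.nonneg x) (hf1 x)) w
  have h3 := abs_setIntegral_mul_fderiv_le E hχ hf1 w
  have h4 := mul_le_mul_of_nonneg_right (h.integral_cutoff_le hχ hν hball) (norm_nonneg w)
  calc _ ≤ |∫ x, χ x * f x * inner ℝ w (σ x) ∂μ| + |∫ x in E, f x * fderiv ℝ χ x w| := by
        refine (abs_sub _ _).trans ?_
        rw [abs_neg]
    _ ≤ _ := by linarith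

end IsPolarGradient

lemma EuclideanSpace.volume_ball_eq {n : ℕ} (hn : 1 ≤ n) (c : EuclideanSpace ℝ (Fin n)) {r : ℝ}
    (hr : 0 ≤ r) : volume (Metric.ball c r) =
      ENNReal.ofReal (r ^ n) * volume (Metric.ball (0 : EuclideanSpace ℝ (Fin n)) 1) := by
  have : Nonempty (Fin n) := ⟨⟨0, hn⟩⟩
  simpa using Measure.addHaar_ball volume c hr

namespace IsPolarGradient

variable {n : ℕ} {E : Set (EuclideanSpace ℝ (Fin n))} {μ : Measure (EuclideanSpace ℝ (Fin n))}
  {σ : EuclideanSpace ℝ (Fin n) → EuclideanSpace ℝ (Fin n)} {c ν : EuclideanSpace ℝ (Fin n)}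
  {ρ r K : ℝ} {χ : EuclideanSpace ℝ (Fin n) → ℝ}

/-- The iteration step, without an isoperimetric inequality. For `x ∈ E ∩ B_ρ` the function `v = χ
1_E` equals `1` at `x`, while `∫ v ≤ t^n` is at most half the volume of the ball `B` of radius `l
t`. So `v(x + h)` differs substantially from `v(x)` on average over `h ∈ B`. Integrating over `x`
and applying the translation estimate bounds the volume by `2 V l t`, with `V` the variation of `v`.
-/
lemma volume_inter_ball_le {l t : ℝ} (h : IsPolarGradient E μ σ) (hE : MeasurableSet E)
    (hχ : IsRadialCutoff c ρ r K χ) (hν : ‖ν‖ = 1)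
    (hball : ∀ s, 0 < s → s ≤ r →
      1 / 2 * μ.real (Metric.ball c s) ≤ ∫ x in Metric.ball c s, inner ℝ ν (σ x) ∂μ)
    (hn : 1 ≤ n) (hK : 0 ≤ K) (hρr : ρ < r) (ht : 0 < t)
    (hl : 1 ≤ l) (hl2 : 2 ≤ l * volume.real (Metric.ball (0 : EuclideanSpace ℝ (Fin n)) 1))
    (hm : volume.real (E ∩ Metric.ball c r) ≤ t ^ n) :
    volume.real (E ∩ Metric.ball c ρ) ≤
      6 * K * l * t / (r - ρ) * volume.real (E ∩ Metric.ball c r) := by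
  set m := volume.real (E ∩ Metric.ball c r) with hm_def
  have hm0 : 0 ≤ m := measureReal_nonneg
  set V : ℝ := 3 * (K / (r - ρ) * m) with hV
  have hrρ : 0 < r - ρ := by linarith
  have hV0 : 0 ≤ V := by positivity
  set v := E.indicator χ with hv
  have hvm : Measurable v := hχ.contDiff.continuous.measurable.indicator hE
  have hv0 : ∀ x, 0 ≤ v x := fun x => indicator_nonneg (fun x _ => hχ.nonneg x) x
  have hv1 : ∀ x, v x ≤ 1 := fun x =>
    indicator_apply_le' (fun _ => hχ.le_one x) (fun _ => zero_le_one)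
  have hfin : volume (E ∩ Metric.ball c r) ≠ ∞ :=
    measure_ne_top_of_subset inter_subset_right measure_ball_lt_top.ne
  have hfinρ : volume (E ∩ Metric.ball c ρ) ≠ ∞ :=
    measure_ne_top_of_subset inter_subset_right measure_ball_lt_top.ne
  have htrans := (h.hasVariationBound_indicator_cutoff hE hχ hν hball).lintegral_translate_le hV0 hvm
    (fun x => by rw [abs_of_nonneg (hv0 x)]; exact hv1 x)
  set B := Metric.ball (0 : EuclideanSpace ℝ (Fin n)) (l * t) with hB
  set G := E ∩ Metric.ball c ρ with hG
  have hGm : MeasurableSet G := hE.inter measurableSet_ball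
  have hvint : ∀ x, ∫⁻ h in B, ENNReal.ofReal (v (x + h)) ≤ ENNReal.ofReal (t ^ n) := by
    intro x
    calc ∫⁻ h in B, ENNReal.ofReal (v (x + h)) ≤ ∫⁻ h, ENNReal.ofReal (v (x + h)) :=
          setLIntegral_le_lintegral _ _
      _ = ∫⁻ h, ENNReal.ofReal (v h) :=
          lintegral_add_left_eq_self (fun h => ENNReal.ofReal (v h)) x
      _ ≤ ∫⁻ h, (E ∩ Metric.ball c r).indicator 1 h := by
          refine lintegral_mono fun y => ?_
          by_cases hy : y ∈ E ∩ Metric.ball c r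
          · rw [indicator_of_mem hy]
            simpa using hv1 y
          · have : v y = 0 := by
              by_cases hyE : y ∈ E
              · rw [hv, indicator_of_mem hyE, hχ.eq_zero y fun h' => hy ⟨hyE, h'⟩]
              · rw [hv, indicator_of_notMem hyE]
            simp [this]
      _ = volume (E ∩ Metric.ball c r) := lintegral_indicator_one (hE.inter measurableSet_ball)
      _ ≤ ENNReal.ofReal (t ^ n) := (ENNReal.le_ofReal_iff_toReal_le hfin (by positivity)).2 hm
  have hpt : ∀ x ∈ G, volume B ≤
      (∫⁻ h in B, ENNReal.ofReal |v (x + h) - v x|) + ENNReal.ofReal (t ^ n) := by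
    intro x hx
    have hvx : v x = 1 := by rw [hv, indicator_of_mem hx.1, hχ.eq_one x hx.2]
    calc volume B = ∫⁻ h in B, 1 := by simp
      _ ≤ ∫⁻ h in B, (ENNReal.ofReal |v (x + h) - v x| + ENNReal.ofReal (v (x + h))) := by
          refine lintegral_mono fun y => ?_
          rw [← ENNReal.ofReal_add (abs_nonneg _) (hv0 _), ← ENNReal.ofReal_one]
          refine ENNReal.ofReal_le_ofReal ?_
          have := neg_abs_le (v (x + y) - v x)
          linarith
      _ = (∫⁻ h in B, ENNReal.ofReal |v (x + h) - v x|) + ∫⁻ h in B, ENNReal.ofReal (v (x + h)) :=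
          lintegral_add_right _ (hvm.comp (measurable_const_add x)).ennreal_ofReal
      _ ≤ _ := by gcongr; exact hvint x
  have hswap : ∫⁻ x in G, ∫⁻ h in B, ENNReal.ofReal |v (x + h) - v x| ≤
      volume B * ENNReal.ofReal (V * (l * t)) := by
    rw [lintegral_lintegral_swap]
    · calc _ ≤ ∫⁻ h in B, ENNReal.ofReal (V * (l * t)) := by
            refine setLIntegral_mono' measurableSet_ball fun h hh => ?_
            refine (setLIntegral_le_lintegral _ _).trans ((htrans h).trans ?_)
            have := (mem_ball_zero_iff.1 hh).le
            gcongr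
        _ = _ := by rw [setLIntegral_const, mul_comm]
    · exact (Measurable.ennreal_ofReal (((hvm.comp (measurable_fst.add measurable_snd)).sub
        (hvm.comp measurable_fst)).abs)).aemeasurable
  have hmain : volume G * volume B ≤
      volume B * ENNReal.ofReal (V * (l * t)) + volume G * ENNReal.ofReal (t ^ n) := by
    calc volume G * volume B = ∫⁻ x in G, volume B := by rw [setLIntegral_const, mul_comm]
      _ ≤ ∫⁻ x in G, ((∫⁻ h in B, ENNReal.ofReal |v (x + h) - v x|) + ENNReal.ofReal (t ^ n)) :=
          setLIntegral_mono' hGm hpt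
      _ = (∫⁻ x in G, ∫⁻ h in B, ENNReal.ofReal |v (x + h) - v x|) +
          volume G * ENNReal.ofReal (t ^ n) := by
          rw [lintegral_add_right _ measurable_const, setLIntegral_const, mul_comm (volume G)]
      _ ≤ _ := by gcongr
  have hBfin : volume B ≠ ∞ := measure_ball_lt_top.ne
  have hreal : volume.real G * volume.real B ≤
      volume.real B * (V * (l * t)) + volume.real G * t ^ n := by
    have h1 := ENNReal.toReal_mono (ENNReal.add_ne_top.2
      ⟨ENNReal.mul_ne_top hBfin ENNReal.ofReal_ne_top,
        ENNReal.mul_ne_top hfinρ ENNReal.ofReal_ne_top⟩) hmain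
    rw [ENNReal.toReal_add (ENNReal.mul_ne_top hBfin ENNReal.ofReal_ne_top)
      (ENNReal.mul_ne_top hfinρ ENNReal.ofReal_ne_top)] at h1
    simp only [ENNReal.toReal_mul] at h1
    rwa [ENNReal.toReal_ofReal (by positivity), ENNReal.toReal_ofReal (by positivity)] at h1
  have hBt : 2 * t ^ n ≤ volume.real B := by
    have h1 : volume.real B =
        (l * t) ^ n * volume.real (Metric.ball (0 : EuclideanSpace ℝ (Fin n)) 1) := by
      rw [measureReal_def, hB, EuclideanSpace.volume_ball_eq hn _ (by positivity),
        ENNReal.toReal_mul, ENNReal.toReal_ofReal (by positivity), measureReal_def]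
    rw [h1, mul_pow]
    have h2 : l ≤ l ^ n := le_self_pow₀ hl (by omega)
    calc 2 * t ^ n
        ≤ l * volume.real (Metric.ball (0 : EuclideanSpace ℝ (Fin n)) 1) * t ^ n := by gcongr
      _ ≤ l ^ n * volume.real (Metric.ball (0 : EuclideanSpace ℝ (Fin n)) 1) * t ^ n := by gcongr
      _ = _ := by ring
  have hBpos : 0 < volume.real B := lt_of_lt_of_le (by positivity) hBt
  have hG0 : 0 ≤ volume.real G := measureReal_nonneg
  have h5 : volume.real G * t ^ n ≤ volume.real G * (volume.real B / 2) := by gcongr; linarith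
  have h6 : volume.real B * volume.real G ≤ volume.real B * (2 * (V * (l * t))) := by linarith
  have h7 := le_of_mul_le_mul_left h6 hBpos
  calc volume.real G ≤ 2 * (V * (l * t)) := h7
    _ = _ := by rw [hV]; ring

end IsPolarGradient

/-- The measure-theoretic lower density estimate of De Giorgi. -/
lemma exists_density_lower_bound {n : ℕ} (hn : 1 ≤ n) : ∃ θ : ℝ, 0 < θ ∧
    ∀ (E : Set (EuclideanSpace ℝ (Fin n))) (μ : Measure (EuclideanSpace ℝ (Fin n)))
      (σ : EuclideanSpace ℝ (Fin n) → EuclideanSpace ℝ (Fin n)) (c ν : EuclideanSpace ℝ (Fin n))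
      (R : ℝ), IsPolarGradient E μ σ → MeasurableSet E → ‖ν‖ = 1 →
      -- Only directional control on balls enters here, so the constant does not depend on the set,
      -- the point or the radius `R`.
      (∀ s, 0 < s → s ≤ R →
        1 / 2 * μ.real (Metric.ball c s) ≤ ∫ x in Metric.ball c s, inner ℝ ν (σ x) ∂μ) →
      (∀ s, 0 < s → 0 < μ (Metric.ball c s)) →
      ∀ r, 0 < r → r ≤ R → (θ * r) ^ n ≤ volume.real (E ∩ Metric.ball c r) := by
  obtain ⟨K, hK, hcut⟩ := exists_isRadialCutoff
  set ω := volume.real (Metric.ball (0 : EuclideanSpace ℝ (Fin n)) 1) with hω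
  have hω0 : 0 < ω :=
    ENNReal.toReal_pos (Metric.measure_ball_pos _ _ one_pos).ne' measure_ball_lt_top.ne
  -- Since `l ≥ 1` and `n ≥ 1`, `l^n ω ≥ l ω ≥ 2`: a ball of radius `l t` has volume at least `2
  -- t^n`.
  set l : ℝ := max 1 (2 / ω) with hl
  have hl1 : 1 ≤ l := le_max_left _ _
  have hl2 : 2 ≤ l * ω := (div_le_iff₀ hω0).1 (le_max_right _ _)
  have hl0 : 0 < l := by linarith
  -- This makes the smallness condition of the iteration an equality with `C = 6 K l`.
  refine ⟨1 / (6 * K * l * (4 * 2 ^ n)), by positivity, ?_⟩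
  intro E μ σ c ν R h hE hν hball hpos r hr hrR
  have hfin := h.isFiniteMeasure
  by_contra! hlt
  set m : ℝ → ℝ := fun s => volume.real (E ∩ Metric.ball c s) with hm
  have hmono : Monotone m := fun s t hst =>
    measureReal_mono (inter_subset_inter_right _ (Metric.ball_subset_ball hst))
      (measure_ne_top_of_subset inter_subset_right measure_ball_lt_top.ne)
  have hzero : m (r / 2) = 0 := by
    refine degiorgi_iteration hn (C := 6 * K * l) (by positivity)
      (θ := 1 / (6 * K * l * (4 * 2 ^ n))) (by positivity) hr (le_of_eq ?_) hmono
      (fun _ => measureReal_nonneg) ?_ hlt.le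
    · field_simp
    · intro t ρ s ht hρ hρs hs hms
      obtain ⟨χ, hχ⟩ := hcut (EuclideanSpace ℝ (Fin n)) c ρ s hρ hρs
      exact h.volume_inter_ball_le hE hχ hν (fun q hq hqs => hball q hq (by linarith)) hn hK.le hρs
        ht hl1 hl2 hms
  -- As `E` is null in `B_{r/2}`, the cutoff estimate forces `μ (B_{r/4}) = 0`, contrary to the
  -- centre lying in the support.
  obtain ⟨χ, hχ⟩ := hcut (EuclideanSpace ℝ (Fin n)) c (r / 4) (r / 2) (by positivity) (by linarith)
  have h1 := h.integral_cutoff_le hχ hν (fun q hq hqs => hball q hq (by linarith))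
  have h2 : volume.real (E ∩ Metric.ball c (r / 2)) = 0 := hzero
  rw [h2, mul_zero, mul_zero] at h1
  have h3 : μ.real (Metric.ball c (r / 4)) ≤ ∫ x, χ x ∂μ := by
    rw [← integral_indicator_one measurableSet_ball]
    refine integral_mono ((integrable_indicator_iff measurableSet_ball).2 integrableOn_const)
      (hχ.contDiff.continuous.integrable_of_hasCompactSupport hχ.hasCompactSupport) fun x => ?_
    refine indicator_le' (fun x hx => ?_) (fun x _ => hχ.nonneg x) x
    rw [hχ.eq_one x hx]; simp
  have h4 : 0 < μ.real (Metric.ball c (r / 4)) :=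
    ENNReal.toReal_pos (hpos _ (by positivity)).ne' (measure_ne_top _ _)
  linarith

/-- Points of the reduced boundary have positive density for both the set and its complement. -/
lemma exists_reducedBoundary_density {n : ℕ} (hn : 1 ≤ n) : ∃ δ : ℝ≥0∞, 0 < δ ∧ δ ≠ ∞ ∧
    ∀ E : Set (EuclideanSpace ℝ (Fin n)), MeasurableSet E → ∀ x ∈ reducedBoundary E,
      ∃ R : ℝ, 0 < R ∧ ∀ r, 0 < r → r ≤ R →
        δ * ENNReal.ofReal (r ^ n) ≤ volume (E ∩ Metric.ball x r) ∧
        δ * ENNReal.ofReal (r ^ n) ≤ volume (Eᶜ ∩ Metric.ball x r) := by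
  obtain ⟨θ, hθ, H⟩ := exists_density_lower_bound hn
  refine ⟨ENNReal.ofReal (θ ^ n), by simpa using pow_pos hθ n, ENNReal.ofReal_ne_top, ?_⟩
  rintro E hE x ⟨μ, σ, h, hpos, ν, hν, hlim⟩
  have hfin := h.isFiniteMeasure
  -- An average within `1/2` of the unit vector `ν` has component at least `1/2` along `ν`.
  obtain ⟨R, hR, hRlim⟩ : ∃ R : ℝ, 0 < R ∧ ∀ r, 0 < r → r ≤ R →
      dist (⨍ y in Metric.ball x r, σ y ∂μ) ν < 1 / 2 := by
    have h1 := (hlim.eventually (Metric.ball_mem_nhds ν (by norm_num : (0 : ℝ) < 1 / 2)))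
    obtain ⟨u, hu, hsub⟩ := (mem_nhdsGT_iff_exists_Ioc_subset (a := (0 : ℝ))).1 h1
    exact ⟨u, hu, fun r hr hru => hsub ⟨hr, hru⟩⟩
  have hσi : Integrable σ μ := Integrable.mono' (integrable_const (1 : ℝ))
    h.measurable.aestronglyMeasurable (h.norm_eq_one.mono fun y hy => hy.le)
  have hball : ∀ s, 0 < s → s ≤ R →
      1 / 2 * μ.real (Metric.ball x s) ≤ ∫ y in Metric.ball x s, inner ℝ ν (σ y) ∂μ := by
    intro s hs hsR
    have hm : 0 < μ.real (Metric.ball x s) := ENNReal.toReal_pos (hpos s hs).ne' (measure_ne_top _ _)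
    have h1 : ∫ y in Metric.ball x s, σ y ∂μ =
        μ.real (Metric.ball x s) • ⨍ y in Metric.ball x s, σ y ∂μ := by
      rw [setAverage_eq, smul_smul, mul_inv_cancel₀ hm.ne', one_smul]
    rw [integral_inner hσi.integrableOn, h1, inner_smul_right, mul_comm]
    refine mul_le_mul_of_nonneg_left ?_ hm.le
    set a := ⨍ y in Metric.ball x s, σ y ∂μ
    have h2 := hRlim s hs hsR
    rw [dist_eq_norm] at h2
    have h3 : inner ℝ ν a = 1 + inner ℝ ν (a - ν) := by
      rw [inner_sub_right, real_inner_self_eq_norm_sq, hν]; ring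
    have h4 := (abs_le.1 (abs_real_inner_le_norm ν (a - ν))).1
    rw [hν, one_mul] at h4
    linarith
  refine ⟨R, hR, fun r hr hrR => ⟨?_, ?_⟩⟩
  · rw [← ENNReal.ofReal_mul (by positivity), ← mul_pow]
    exact ENNReal.ofReal_le_of_le_toReal (H E μ σ x ν R h hE hν hball hpos r hr hrR)
  · rw [← ENNReal.ofReal_mul (by positivity), ← mul_pow]
    refine ENNReal.ofReal_le_of_le_toReal (H Eᶜ μ _ x (-ν) R (h.compl hE.nullMeasurableSet)
      hE.compl (by simpa using hν) ?_ hpos r hr hrR)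
    simpa using hball

/-! ### The Gaussian kernel: mass and first moment. -/

section Gaussian

variable {n : ℕ}

lemma gaussianDensity_nonneg (x : EuclideanSpace ℝ (Fin n)) : 0 ≤ gaussianDensity x := by
  unfold gaussianDensity; positivity

lemma continuous_gaussianDensity :
    Continuous (gaussianDensity : EuclideanSpace ℝ (Fin n) → ℝ) := by
  unfold gaussianDensity; fun_prop

lemma integrable_exp_neg_mul_norm_sq {b : ℝ} (hb : 0 < b) :
    Integrable (fun x : EuclideanSpace ℝ (Fin n) => Real.exp (-b * ‖x‖ ^ 2)) := by
  by_contra h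
  have h1 := GaussianFourier.integral_rexp_neg_mul_sq_norm (V := EuclideanSpace ℝ (Fin n)) hb
  rw [integral_undef h] at h1
  have : 0 < (Real.pi / b) ^ ((Module.finrank ℝ (EuclideanSpace ℝ (Fin n)) : ℝ) / 2) := by
    positivity
  linarith

lemma integral_gaussianDensity :
    ∫ x : EuclideanSpace ℝ (Fin n), gaussianDensity x = 1 := by
  have h1 := GaussianFourier.integral_rexp_neg_mul_sq_norm (V := EuclideanSpace ℝ (Fin n))
    (b := 1 / 2) (by norm_num)
  have h2 : ∀ x : EuclideanSpace ℝ (Fin n), -‖x‖ ^ 2 / 2 = -(1 / 2) * ‖x‖ ^ 2 := fun x => by ring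
  simp_rw [gaussianDensity, integral_const_mul, h2, h1, finrank_euclideanSpace_fin]
  rw [show Real.pi / (1 / 2) = 2 * Real.pi by ring, ← Real.rpow_add (by positivity)]
  ring_nf
  simp

lemma integrable_gaussianDensity :
    Integrable (gaussianDensity : EuclideanSpace ℝ (Fin n) → ℝ) :=
  .of_integral_ne_zero (by simp [integral_gaussianDensity])

lemma integrable_norm_mul_gaussianDensity :
    Integrable (fun x : EuclideanSpace ℝ (Fin n) => ‖x‖ * gaussianDensity x) := by
  refine Integrable.mono' ((integrable_exp_neg_mul_norm_sq (n := n)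
    (b := 1 / 4) (by norm_num)).const_mul ((2 * Real.pi) ^ (-(n : ℝ) / 2)))
    (continuous_norm.mul continuous_gaussianDensity).aestronglyMeasurable
    (Eventually.of_forall fun x => ?_)
  rw [Real.norm_eq_abs, abs_of_nonneg (mul_nonneg (norm_nonneg _) (gaussianDensity_nonneg _)),
    gaussianDensity, mul_left_comm]
  gcongr
  have h1 : ‖x‖ ≤ Real.exp (‖x‖ ^ 2 / 4) := by
    have := Real.add_one_le_exp (‖x‖ ^ 2 / 4)
    nlinarith [sq_nonneg (‖x‖ / 2 - 1)]
  calc ‖x‖ * Real.exp (-‖x‖ ^ 2 / 2)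
      ≤ Real.exp (‖x‖ ^ 2 / 4) * Real.exp (-‖x‖ ^ 2 / 2) := by gcongr
    _ = Real.exp (-(1 / 4) * ‖x‖ ^ 2) := by rw [← Real.exp_add]; ring_nf

lemma scaledGaussian_nonneg {ε : ℝ} (hε : 0 < ε) (x : EuclideanSpace ℝ (Fin n)) :
    0 ≤ scaledGaussian ε x :=
  mul_nonneg (by positivity) (gaussianDensity_nonneg _)

lemma continuous_scaledGaussian (ε : ℝ) :
    Continuous (scaledGaussian ε : EuclideanSpace ℝ (Fin n) → ℝ) :=
  continuous_const.mul (continuous_gaussianDensity.comp (continuous_const_smul _))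

lemma integrable_scaledGaussian {ε : ℝ} (hε : 0 < ε) :
    Integrable (scaledGaussian ε : EuclideanSpace ℝ (Fin n) → ℝ) :=
  (integrable_gaussianDensity.comp_smul (inv_ne_zero hε.ne')).const_mul _

lemma integral_scaledGaussian {ε : ℝ} (hε : 0 < ε) :
    ∫ x : EuclideanSpace ℝ (Fin n), scaledGaussian ε x = 1 := by
  simp only [scaledGaussian]
  rw [integral_const_mul, Measure.integral_comp_inv_smul, integral_gaussianDensity,
    finrank_euclideanSpace_fin, abs_of_pos (by positivity), smul_eq_mul]
  field_simp

lemma integral_norm_mul_scaledGaussian {ε : ℝ} (hε : 0 < ε) :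
    ∫ x : EuclideanSpace ℝ (Fin n), ‖x‖ * scaledGaussian ε x =
      ε * ∫ x : EuclideanSpace ℝ (Fin n), ‖x‖ * gaussianDensity x := by
  have h1 : ∀ x : EuclideanSpace ℝ (Fin n), ‖x‖ * scaledGaussian ε x =
      ε * (1 / ε ^ n) * (‖ε⁻¹ • x‖ * gaussianDensity (ε⁻¹ • x)) := by
    intro x
    rw [scaledGaussian, norm_smul, Real.norm_of_nonneg (by positivity)]
    field_simp
  simp_rw [h1]
  rw [integral_const_mul, Measure.integral_comp_inv_smul volume
    (fun x : EuclideanSpace ℝ (Fin n) => ‖x‖ * gaussianDensity x) ε, finrank_euclideanSpace_fin,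
    abs_of_pos (by positivity), smul_eq_mul]
  field_simp

lemma integrable_norm_mul_scaledGaussian {ε : ℝ} (hε : 0 < ε) :
    Integrable (fun x : EuclideanSpace ℝ (Fin n) => ‖x‖ * scaledGaussian ε x) := by
  have h1 : ∀ x : EuclideanSpace ℝ (Fin n), ‖x‖ * scaledGaussian ε x =
      ε * (1 / ε ^ n) * (‖ε⁻¹ • x‖ * gaussianDensity (ε⁻¹ • x)) := by
    intro x
    rw [scaledGaussian, norm_smul, Real.norm_of_nonneg (by positivity)]
    field_simp
  simp_rw [h1]
  exact ((integrable_norm_mul_gaussianDensity (n := n)).comp_smul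
    (inv_ne_zero hε.ne')).const_mul _

end Gaussian

/-! ### The mollified indicator and its `L¹` distance to the indicator. -/

section Mollified

variable {n : ℕ} {E F : Set (EuclideanSpace ℝ (Fin n))}

lemma mollifiedIndicator_congr_ae (hEF : E =ᵐ[volume] F) (ε : ℝ) :
    mollifiedIndicator E ε = mollifiedIndicator F ε := by
  ext x
  refine integral_congr_ae ?_
  filter_upwards [indicator_ae_eq_of_ae_eq_set (f := fun _ => (1 : ℝ)) hEF] with t ht
  simp only [ht]

lemma mollifiedIndicator_eq (E : Set (EuclideanSpace ℝ (Fin n))) (ε : ℝ)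
    (x : EuclideanSpace ℝ (Fin n)) : mollifiedIndicator E ε x =
      ∫ z, E.indicator (fun _ => (1 : ℝ)) (x - z) * scaledGaussian ε z := by
  simp [mollifiedIndicator, convolution_eq_swap]

lemma measurable_indicator_one (hE : MeasurableSet E) :
    Measurable (E.indicator fun _ => (1 : ℝ)) := measurable_const.indicator hE

lemma measurable_mollifiedIndicator (hE : MeasurableSet E) (ε : ℝ) :
    Measurable (mollifiedIndicator E ε) := by
  have h1 : Measurable (Function.uncurry fun x z : EuclideanSpace ℝ (Fin n) =>
      E.indicator (fun _ => (1 : ℝ)) (x - z) * scaledGaussian ε z) :=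
    ((measurable_indicator_one hE).comp (measurable_fst.sub measurable_snd)).mul
      ((continuous_scaledGaussian ε).measurable.comp measurable_snd)
  have h2 := h1.stronglyMeasurable.integral_prod_right (ν := volume)
  have h3 : mollifiedIndicator E ε = fun x =>
      ∫ z, E.indicator (fun _ => (1 : ℝ)) (x - z) * scaledGaussian ε z :=
    funext (mollifiedIndicator_eq E ε)
  rw [h3]
  exact h2.measurable

lemma integrable_indicator_sub_mul_scaledGaussian (hE : MeasurableSet E) {ε : ℝ} (hε : 0 < ε)
    (x : EuclideanSpace ℝ (Fin n)) :
    Integrable fun z => E.indicator (fun _ => (1 : ℝ)) (x - z) * scaledGaussian ε z := by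
  refine (integrable_scaledGaussian hε).bdd_mul (c := 1)
    ((measurable_indicator_one hE).comp (measurable_const.sub measurable_id)).aestronglyMeasurable
    (Eventually.of_forall fun z => ?_)
  by_cases hz : x - z ∈ E <;> simp [hz]

lemma mollifiedIndicator_mem_Icc (hE : MeasurableSet E) {ε : ℝ} (hε : 0 < ε)
    (x : EuclideanSpace ℝ (Fin n)) : mollifiedIndicator E ε x ∈ Icc (0 : ℝ) 1 := by
  rw [mollifiedIndicator_eq]
  constructor
  · exact integral_nonneg fun z => mul_nonneg (indicator_nonneg (fun _ _ => zero_le_one) _)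
      (scaledGaussian_nonneg hε z)
  · refine (integral_mono (integrable_indicator_sub_mul_scaledGaussian hE hε x)
      (integrable_scaledGaussian hε) fun z => ?_).trans_eq (integral_scaledGaussian hε)
    exact mul_le_of_le_one_left (scaledGaussian_nonneg hε z)
      (indicator_apply_le' (fun _ => le_rfl) (fun _ => zero_le_one))

/-- The difference is a Gaussian average of translation differences of `1_E`, each of `L¹` size at
most `|∇1_E|(ℝⁿ) ‖z‖`; the first moment scales like `ε`. Only the difference is integrated, so `E`
may have infinite volume. -/
lemma lintegral_indicator_sub_mollifiedIndicator_le {μ : Measure (EuclideanSpace ℝ (Fin n))}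
    {σ : EuclideanSpace ℝ (Fin n) → EuclideanSpace ℝ (Fin n)} (h : IsPolarGradient E μ σ)
    (hE : MeasurableSet E) {ε : ℝ} (hε : 0 < ε) :
    ∫⁻ x, ENNReal.ofReal |E.indicator (fun _ => (1 : ℝ)) x - mollifiedIndicator E ε x| ≤
      ENNReal.ofReal (μ.real univ *
        (∫ x : EuclideanSpace ℝ (Fin n), ‖x‖ * gaussianDensity x) * ε) := by
  set u := E.indicator (fun _ => (1 : ℝ)) with hu
  have hum : Measurable u := measurable_indicator_one hE
  have hu1 : ∀ x, |u x| ≤ 1 := fun x => by by_cases hx : x ∈ E <;> simp [hu, hx]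
  have htr := (h.hasVariationBound_indicator_one hE).lintegral_translate_le
    measureReal_nonneg hum hu1
  have hpt : ∀ x, ENNReal.ofReal |u x - mollifiedIndicator E ε x| ≤
      ∫⁻ z, ENNReal.ofReal |u (x + -z) - u x| * ENNReal.ofReal (scaledGaussian ε z) := by
    intro x
    have h1 : u x - mollifiedIndicator E ε x = ∫ z, (u x - u (x - z)) * scaledGaussian ε z := by
      simp_rw [sub_mul]
      rw [integral_sub ((integrable_scaledGaussian hε).const_mul _)
        (integrable_indicator_sub_mul_scaledGaussian hE hε x), integral_const_mul,
        integral_scaledGaussian hε, mul_one, mollifiedIndicator_eq]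
    rw [h1, ← Real.norm_eq_abs, ofReal_norm]
    refine (enorm_integral_le_lintegral_enorm _).trans (lintegral_mono fun z => ?_)
    rw [enorm_mul, ← ofReal_norm, ← ofReal_norm, Real.norm_eq_abs, Real.norm_eq_abs,
      abs_of_nonneg (scaledGaussian_nonneg hε z), abs_sub_comm, ← sub_eq_add_neg]
  calc _ ≤ ∫⁻ x, ∫⁻ z, ENNReal.ofReal |u (x + -z) - u x| * ENNReal.ofReal (scaledGaussian ε z) :=
        lintegral_mono hpt
    _ = ∫⁻ z, ∫⁻ x, ENNReal.ofReal |u (x + -z) - u x| * ENNReal.ofReal (scaledGaussian ε z) := by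
        refine lintegral_lintegral_swap (Measurable.aemeasurable ?_)
        exact (((hum.comp (measurable_fst.add measurable_snd.neg)).sub
          (hum.comp measurable_fst)).abs.ennreal_ofReal).mul
          (((continuous_scaledGaussian ε).measurable.comp measurable_snd).ennreal_ofReal)
    _ ≤ ∫⁻ z, ENNReal.ofReal (μ.real univ * (‖z‖ * scaledGaussian ε z)) := by
        refine lintegral_mono fun z => ?_
        rw [lintegral_mul_const' _ _ ENNReal.ofReal_ne_top, ← mul_assoc, ENNReal.ofReal_mul (by positivity)]
        gcongr
        simpa using htr (-z)
    _ = _ := by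
        rw [← ofReal_integral_eq_lintegral_ofReal
          ((integrable_norm_mul_scaledGaussian hε).const_mul _)
          (Eventually.of_forall fun z => mul_nonneg measureReal_nonneg
            (mul_nonneg (norm_nonneg _) (scaledGaussian_nonneg hε z))),
          integral_const_mul, integral_norm_mul_scaledGaussian hε]
        ring_nf

lemma reducedBoundary_congr_ae (hEF : E =ᵐ[volume] F) : reducedBoundary E = reducedBoundary F := by
  ext x
  exact ⟨fun ⟨μ, σ, h, hx⟩ => ⟨μ, σ, h.congr_ae hEF, hx⟩,
    fun ⟨μ, σ, h, hx⟩ => ⟨μ, σ, h.congr_ae hEF.symm, hx⟩⟩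

end Mollified

/-! ### Energy in one ball from the density of both phases. -/

section Energy

variable {n : ℕ}

/-- The integrand of `halfEnergy`, as a function on the product space. -/
noncomputable def halfEnergyDensity (φ : EuclideanSpace ℝ (Fin n) → ℝ)
    (p : EuclideanSpace ℝ (Fin n) × EuclideanSpace ℝ (Fin n)) : ℝ≥0∞ :=
  ENNReal.ofReal (|φ p.2 - φ p.1| ^ 2 / ‖p.2 - p.1‖ ^ (n + 1))

/-- The pairs of points of `B` at distance in `[α, β)`. -/
def distanceBand (B : Set (EuclideanSpace ℝ (Fin n))) (α β : ℝ) :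
    Set (EuclideanSpace ℝ (Fin n) × EuclideanSpace ℝ (Fin n)) :=
  {p | p ∈ B ×ˢ B ∧ ‖p.2 - p.1‖ ∈ Ico α β}

lemma measurableSet_distanceBand {B : Set (EuclideanSpace ℝ (Fin n))} (hB : MeasurableSet B)
    (α β : ℝ) : MeasurableSet (distanceBand B α β) :=
  (hB.prod hB).inter ((measurable_snd.sub measurable_fst).norm measurableSet_Ico)

lemma measurable_halfEnergyDensity {φ : EuclideanSpace ℝ (Fin n) → ℝ} (hφ : Measurable φ) :
    Measurable (halfEnergyDensity φ) :=
  (((((hφ.comp measurable_snd).sub (hφ.comp measurable_fst)).abs).pow_const 2).div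
    (((measurable_snd.sub measurable_fst).norm).pow_const _)).ennreal_ofReal

lemma halfEnergy_eq_setLIntegral {φ : EuclideanSpace ℝ (Fin n) → ℝ} (hφ : Measurable φ)
    (B : Set (EuclideanSpace ℝ (Fin n))) :
    halfEnergy φ B = ∫⁻ p in B ×ˢ B, halfEnergyDensity φ p ∂(volume.prod volume) := by
  rw [← Measure.prod_restrict, lintegral_prod _ (measurable_halfEnergyDensity hφ).aemeasurable]
  rfl

/-- Write `1 = (φ x - φ y) + e` with `e = (1 - φ x) + φ y`. Then `1 ≤ 2 |φ x - φ y|² + 2 e²`, and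
`e² ≤ 2 e` because `0 ≤ e ≤ 2`. The error is thus linear, matching the available `L¹` bound. -/
lemma one_le_of_indicator {E : Set (EuclideanSpace ℝ (Fin n))}
    {φ : EuclideanSpace ℝ (Fin n) → ℝ} (hφ : ∀ x, φ x ∈ Icc (0 : ℝ) 1)
    {x y : EuclideanSpace ℝ (Fin n)} (hx : x ∈ E) (hy : y ∉ E) :
    (1 : ℝ≥0∞) ≤ 2 * ENNReal.ofReal (|φ y - φ x| ^ 2) +
      (4 * ENNReal.ofReal |E.indicator (fun _ => (1 : ℝ)) x - φ x| +
        4 * ENNReal.ofReal |E.indicator (fun _ => (1 : ℝ)) y - φ y|) := by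
  have h2 : (2 : ℝ≥0∞) = ENNReal.ofReal 2 := by simp
  have h4 : (4 : ℝ≥0∞) = ENNReal.ofReal 4 := by simp
  rw [indicator_of_mem hx, indicator_of_notMem hy, h2, h4, ← ENNReal.ofReal_mul (by norm_num),
    ← ENNReal.ofReal_mul (by norm_num), ← ENNReal.ofReal_mul (by norm_num),
    ← ENNReal.ofReal_add (by positivity) (by positivity),
    ← ENNReal.ofReal_add (by positivity) (by positivity), ← ENNReal.ofReal_one]
  refine ENNReal.ofReal_le_ofReal ?_
  have hx' := hφ x
  have hy' := hφ y
  rw [sq_abs, abs_of_nonneg (by linarith [hx'.2]), zero_sub, abs_neg, abs_of_nonneg hy'.1]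
  have h0 : 0 ≤ 1 - φ x + φ y := by linarith [hx'.2, hy'.1]
  nlinarith [sq_nonneg (φ y - φ x + (1 - φ x + φ y)), sq_nonneg (φ y - φ x), hx'.1, hx'.2, hy'.1,
    hy'.2, sq_nonneg (1 - φ x - φ y), sq_nonneg (φ x - φ y - (1 - φ x + φ y))]

lemma prod_distance_lt_le (c : EuclideanSpace ℝ (Fin n)) (s α : ℝ) :
    (volume.prod volume) {p : EuclideanSpace ℝ (Fin n) × EuclideanSpace ℝ (Fin n) |
      p ∈ Metric.ball c s ×ˢ Metric.ball c s ∧ ‖p.2 - p.1‖ < α} ≤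
      volume (Metric.ball c s) * volume (Metric.ball (0 : EuclideanSpace ℝ (Fin n)) α) := by
  have hm : MeasurableSet {p : EuclideanSpace ℝ (Fin n) × EuclideanSpace ℝ (Fin n) |
      p ∈ Metric.ball c s ×ˢ Metric.ball c s ∧ ‖p.2 - p.1‖ < α} :=
    (measurableSet_ball.prod measurableSet_ball).inter
      (measurableSet_lt (measurable_snd.sub measurable_fst).norm measurable_const)
  rw [Measure.prod_apply hm]
  calc _ ≤ ∫⁻ x, (Metric.ball c s).indicator
        (fun _ => volume (Metric.ball (0 : EuclideanSpace ℝ (Fin n)) α)) x := by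
        refine lintegral_mono fun x => ?_
        by_cases hx : x ∈ Metric.ball c s
        · rw [indicator_of_mem hx, ← Measure.addHaar_ball_center volume x α]
          refine measure_mono fun y hy => ?_
          rw [mem_ball_iff_norm]
          exact hy.2
        · rw [indicator_of_notMem hx]
          refine le_of_eq (measure_mono_null (t := ∅) (fun y hy => ?_) measure_empty)
          exact hx hy.1.1
    _ = _ := by rw [lintegral_indicator_const measurableSet_ball, mul_comm]

/-- Counts pairs in `(E ∩ B) × (Eᶜ ∩ B)`: the smallness of `a` makes pairs closer than `a s` at most
half of the lower bound `δ² s^(2n)`. The remaining pairs lie in the band, where the energy kernel is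
at least `(2s)^(-n-1)`. -/
lemma density_sq_le_local_energy (hn : 1 ≤ n) {E : Set (EuclideanSpace ℝ (Fin n))}
    (hE : MeasurableSet E) {φ : EuclideanSpace ℝ (Fin n) → ℝ} (hφ : Measurable φ)
    (hφ1 : ∀ x, φ x ∈ Icc (0 : ℝ) 1) {c : EuclideanSpace ℝ (Fin n)} {s a : ℝ} {δ : ℝ≥0∞}
    (hs : 0 < s) (ha : 0 < a) (hδ : δ ≠ ∞)
    (haδ : volume (Metric.ball (0 : EuclideanSpace ℝ (Fin n)) 1) ^ 2 * ENNReal.ofReal (a ^ n) ≤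
      δ ^ 2 / 2)
    (h1 : δ * ENNReal.ofReal (s ^ n) ≤ volume (E ∩ Metric.ball c s))
    (h2 : δ * ENNReal.ofReal (s ^ n) ≤ volume (Eᶜ ∩ Metric.ball c s)) :
    δ ^ 2 * ENNReal.ofReal (s ^ n) ≤
      ENNReal.ofReal (2 ^ (n + 3) * s) *
        (∫⁻ p in distanceBand (Metric.ball c s) (a * s) (2 * s), halfEnergyDensity φ p
          ∂(volume.prod volume)) +
      16 * volume (Metric.ball (0 : EuclideanSpace ℝ (Fin n)) 1) *
        ∫⁻ x in Metric.ball c s, ENNReal.ofReal |E.indicator (fun _ => (1 : ℝ)) x - φ x| := by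
  set B := Metric.ball c s with hB
  set D := distanceBand B (a * s) (2 * s) with hD
  set ω := volume (Metric.ball (0 : EuclideanSpace ℝ (Fin n)) 1) with hω
  set S := ENNReal.ofReal (s ^ n) with hS
  set e : EuclideanSpace ℝ (Fin n) → ℝ≥0∞ :=
    fun x => ENNReal.ofReal |E.indicator (fun _ => (1 : ℝ)) x - φ x| with he
  set X := ∫⁻ p in D, halfEnergyDensity φ p ∂(volume.prod volume) with hX
  set Y := ∫⁻ x in B, e x with hY
  have hem : Measurable e := ((measurable_indicator_one hE).sub hφ).abs.ennreal_ofReal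
  have hBm : MeasurableSet B := measurableSet_ball
  have hDm : MeasurableSet D := measurableSet_distanceBand hBm _ _
  have hDB : D ⊆ B ×ˢ B := fun p hp => hp.1
  have hBvol : volume B = S * ω := EuclideanSpace.volume_ball_eq hn c hs.le
  have hS0 : S ≠ 0 := by simpa [hS] using pow_pos hs n
  have hSt : S ≠ ∞ := ENNReal.ofReal_ne_top
  set N := {p : EuclideanSpace ℝ (Fin n) × EuclideanSpace ℝ (Fin n) |
      p ∈ B ×ˢ B ∧ ‖p.2 - p.1‖ < a * s} with hN
  have hNle : (volume.prod volume) N ≤ δ ^ 2 / 2 * S * S := by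
    calc _ ≤ volume B * volume (Metric.ball (0 : EuclideanSpace ℝ (Fin n)) (a * s)) :=
          prod_distance_lt_le c s (a * s)
      _ = ω ^ 2 * ENNReal.ofReal (a ^ n) * S * S := by
          rw [hBvol, EuclideanSpace.volume_ball_eq hn _ (by positivity), mul_pow,
            ENNReal.ofReal_mul (by positivity)]
          ring
      _ ≤ _ := by gcongr
  have hG : ∫⁻ p in D, ENNReal.ofReal (|φ p.2 - φ p.1| ^ 2) ∂(volume.prod volume) ≤
      ENNReal.ofReal ((2 * s) ^ (n + 1)) * X := by
    rw [hX, ← lintegral_const_mul' _ _ ENNReal.ofReal_ne_top]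
    refine setLIntegral_mono' hDm fun p hp => ?_
    rw [halfEnergyDensity, ← ENNReal.ofReal_mul (by positivity)]
    refine ENNReal.ofReal_le_ofReal ?_
    have hpos : 0 < ‖p.2 - p.1‖ := lt_of_lt_of_le (by positivity) hp.2.1
    rw [mul_div_assoc', le_div_iff₀ (by positivity), mul_comm]
    gcongr
    exact hp.2.2.le
  have hY1 : ∫⁻ p in D, e p.1 ∂(volume.prod volume) ≤ Y * (S * ω) := by
    calc _ ≤ ∫⁻ p in B ×ˢ B, e p.1 * 1 ∂(volume.prod volume) := by
          simpa using lintegral_mono_set hDB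
      _ = _ := by
          rw [← Measure.prod_restrict, lintegral_prod_mul (f := e) (g := fun _ => 1)
            hem.aemeasurable aemeasurable_const]
          simp [hBvol, hY]
  have hY2 : ∫⁻ p in D, e p.2 ∂(volume.prod volume) ≤ Y * (S * ω) := by
    calc _ ≤ ∫⁻ p in B ×ˢ B, 1 * e p.2 ∂(volume.prod volume) := by
          simpa using lintegral_mono_set hDB
      _ = _ := by
          rw [← Measure.prod_restrict, lintegral_prod_mul (f := fun _ => 1) (g := e)
            aemeasurable_const hem.aemeasurable]
          simp [hBvol, hY, mul_comm]
  set Q := (E ∩ B) ×ˢ (Eᶜ ∩ B) with hQ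
  have hQm : MeasurableSet Q := (hE.inter hBm).prod (hE.compl.inter hBm)
  have hQsub : Q ⊆ N ∪ Q ∩ D := by
    intro p hp
    have hpB : p ∈ B ×ˢ B := ⟨hp.1.2, hp.2.2⟩
    by_cases hlt : ‖p.2 - p.1‖ < a * s
    · exact Or.inl ⟨hpB, hlt⟩
    · refine Or.inr ⟨hp, hpB, not_lt.1 hlt, ?_⟩
      have h3 := mem_ball_iff_norm.1 hp.1.2
      have h4 := mem_ball_iff_norm.1 hp.2.2
      calc ‖p.2 - p.1‖ = ‖(p.2 - c) - (p.1 - c)‖ := by congr 1; abel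
        _ ≤ ‖p.2 - c‖ + ‖p.1 - c‖ := norm_sub_le _ _
        _ < 2 * s := by linarith
  have hGm : Measurable fun p : EuclideanSpace ℝ (Fin n) × EuclideanSpace ℝ (Fin n) =>
      ENNReal.ofReal (|φ p.2 - φ p.1| ^ 2) :=
    ((((hφ.comp measurable_snd).sub (hφ.comp measurable_fst)).abs).pow_const 2).ennreal_ofReal
  have hQD : (volume.prod volume) (Q ∩ D) ≤
      2 * (ENNReal.ofReal ((2 * s) ^ (n + 1)) * X) + (4 * (Y * (S * ω)) + 4 * (Y * (S * ω))) := by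
    calc (volume.prod volume) (Q ∩ D) = ∫⁻ p in Q ∩ D, 1 ∂(volume.prod volume) := by simp
      _ ≤ ∫⁻ p in Q ∩ D, (2 * ENNReal.ofReal (|φ p.2 - φ p.1| ^ 2) + (4 * e p.1 + 4 * e p.2))
            ∂(volume.prod volume) :=
          setLIntegral_mono' (hQm.inter hDm) fun p hp =>
            one_le_of_indicator hφ1 hp.1.1.1 hp.1.2.1
      _ ≤ ∫⁻ p in D, (2 * ENNReal.ofReal (|φ p.2 - φ p.1| ^ 2) + (4 * e p.1 + 4 * e p.2))
            ∂(volume.prod volume) := lintegral_mono_set inter_subset_right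
      _ = 2 * (∫⁻ p in D, ENNReal.ofReal (|φ p.2 - φ p.1| ^ 2) ∂(volume.prod volume)) +
            (4 * (∫⁻ p in D, e p.1 ∂(volume.prod volume)) +
              4 * ∫⁻ p in D, e p.2 ∂(volume.prod volume)) := by
          have hm1 : Measurable fun p : EuclideanSpace ℝ (Fin n) × EuclideanSpace ℝ (Fin n) =>
            e p.1 := hem.comp measurable_fst
          have hm2 : Measurable fun p : EuclideanSpace ℝ (Fin n) × EuclideanSpace ℝ (Fin n) =>
            e p.2 := hem.comp measurable_snd
          rw [lintegral_add_left (hGm.const_mul _), lintegral_add_left (hm1.const_mul _),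
            lintegral_const_mul _ hGm, lintegral_const_mul _ hm1, lintegral_const_mul _ hm2]
      _ ≤ _ := by gcongr
  have hmain : δ ^ 2 / 2 * S * S + δ ^ 2 / 2 * S * S ≤ δ ^ 2 / 2 * S * S +
      (2 * (ENNReal.ofReal ((2 * s) ^ (n + 1)) * X) +
        (4 * (Y * (S * ω)) + 4 * (Y * (S * ω)))) := by
    calc δ ^ 2 / 2 * S * S + δ ^ 2 / 2 * S * S = (δ * S) * (δ * S) := by
          rw [← add_mul, ← add_mul, ENNReal.add_halves]; ring
      _ ≤ volume (E ∩ B) * volume (Eᶜ ∩ B) := by gcongr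
      _ = (volume.prod volume) Q := (Measure.prod_prod _ _).symm
      _ ≤ (volume.prod volume) N + (volume.prod volume) (Q ∩ D) :=
          (measure_mono hQsub).trans (measure_union_le _ _)
      _ ≤ _ := by gcongr
  have hfin : δ ^ 2 / 2 * S * S ≠ ∞ := by
    refine ENNReal.mul_ne_top (ENNReal.mul_ne_top ?_ hSt) hSt
    exact ENNReal.div_ne_top (ENNReal.pow_ne_top hδ) (by norm_num)
  have hhalf := (ENNReal.add_le_add_iff_left hfin).1 hmain
  have h2s : 4 * ENNReal.ofReal ((2 * s) ^ (n + 1)) = ENNReal.ofReal (2 ^ (n + 3) * s) * S := by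
    rw [show (4 : ℝ≥0∞) = ENNReal.ofReal 4 by simp, hS, ← ENNReal.ofReal_mul (by norm_num),
      ← ENNReal.ofReal_mul (by positivity)]
    congr 1; ring
  -- Both sides carry a spare factor `s^n`, which is cancelled here.
  refine (ENNReal.mul_le_mul_iff_left hS0 hSt).1 ?_
  calc δ ^ 2 * S * S = 2 * (δ ^ 2 / 2 * S * S) := by
        have hc : δ ^ 2 / 2 * 2 = δ ^ 2 := ENNReal.div_mul_cancel (by norm_num) (by norm_num)
        generalize δ ^ 2 / 2 = η at hc
        rw [← hc]; ring
    _ ≤ 2 * (2 * (ENNReal.ofReal ((2 * s) ^ (n + 1)) * X) +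
        (4 * (Y * (S * ω)) + 4 * (Y * (S * ω)))) := by gcongr
    _ = 4 * ENNReal.ofReal ((2 * s) ^ (n + 1)) * X + 16 * ω * Y * S := by ring
    _ = _ := by rw [h2s]; ring

end Energy

/-! ### Separated families and Hausdorff measure. -/

/-- A lower bound, at all small scales, of the cardinality of separated sets by the Hausdorff
measure. -/
lemma exists_separated_of_lt_hausdorffMeasure {X : Type*} [MetricSpace X] [MeasurableSpace X]
    [BorelSpace X] [SecondCountableTopology X] {d : ℝ} (hd : 0 ≤ d) {A : Set X}
    {M : ℝ≥0∞} (hM : M < Measure.hausdorffMeasure d A) :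
    ∃ s₀ : ℝ, 0 < s₀ ∧ ∀ s, 0 < s → s ≤ s₀ → ∃ u ⊆ A, u.Countable ∧
      u.PairwiseDisjoint (fun x => Metric.ball x s) ∧
      M ≤ ∑' _ : u, ENNReal.ofReal (10 * s) ^ d := by
  -- Vitali selection: disjoint balls of radius `s` whose fivefold enlargements cover, hence the
  -- diameters `10 s`. A family is chosen for every real `s` so that the liminf bound along `s → 0⁺`
  -- applies; for `s ≤ 0` it is an empty dummy.
  have hcov : ∀ s : ℝ, ∃ u : Set X, u ⊆ A ∧ u.Countable ∧ (0 < s →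
      u.PairwiseDisjoint (fun x => Metric.ball x s) ∧
      A ⊆ ⋃ x : u, Metric.closedBall (x : X) (5 * s)) := by
    intro s
    by_cases hs : 0 < s
    · obtain ⟨u, huA, hdisj, hcover⟩ := Vitali.exists_disjoint_subfamily_covering_enlargement_closedBall
        A (fun x : X => x) (fun _ => s) s (fun _ _ => le_rfl) 5 (by norm_num)
      have hdisj' : u.PairwiseDisjoint (fun x => Metric.ball x s) :=
        hdisj.mono fun x => Metric.ball_subset_closedBall
      refine ⟨u, huA, hdisj'.countable_of_isOpen (fun x _ => Metric.isOpen_ball)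
        (fun x _ => Metric.nonempty_ball.2 hs), fun _ => ⟨hdisj', fun x hx => ?_⟩⟩
      obtain ⟨b, hb, hsub⟩ := hcover x hx
      exact mem_iUnion.2 ⟨⟨b, hb⟩, hsub (Metric.mem_closedBall_self hs.le)⟩
    · exact ⟨∅, empty_subset _, countable_empty, fun h => absurd h hs⟩
  choose u huA huc hu using hcov
  have : ∀ s, Countable (u s) := fun s => (huc s).to_subtype
  have hdiam : ∀ᶠ s in 𝓝[>] (0 : ℝ), ∀ x : u s,
      Metric.ediam (Metric.closedBall (x : X) (5 * s)) ≤ ENNReal.ofReal (10 * s) := by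
    filter_upwards [self_mem_nhdsWithin] with s hs x
    rw [mem_Ioi] at hs
    rw [← Metric.closedEBall_ofReal (by positivity)]
    refine Metric.ediam_closedEBall_le.trans (le_of_eq ?_)
    rw [show (2 : ℝ≥0∞) = ENNReal.ofReal 2 by simp, ← ENNReal.ofReal_mul (by norm_num)]
    congr 1; ring
  have hlim : Tendsto (fun s : ℝ => ENNReal.ofReal (10 * s)) (𝓝[>] 0) (𝓝 0) := by
    have : Tendsto (fun s : ℝ => ENNReal.ofReal (10 * s)) (𝓝 0) (𝓝 (ENNReal.ofReal (10 * 0))) :=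
      (ENNReal.continuous_ofReal.comp (continuous_const.mul continuous_id)).tendsto 0
    simpa using this.mono_left nhdsWithin_le_nhds
  have hH := Measure.hausdorffMeasure_le_liminf_tsum d A _ hlim
    (fun s (x : u s) => Metric.closedBall (x : X) (5 * s)) hdiam
    (by filter_upwards [self_mem_nhdsWithin] with s hs using (hu s hs).2)
  have hev := eventually_lt_of_lt_liminf (lt_of_lt_of_le hM hH)
  obtain ⟨s₀, hs₀, hsub⟩ := (mem_nhdsGT_iff_exists_Ioc_subset (a := (0 : ℝ))).1 (hev.and hdiam)
  refine ⟨s₀, hs₀, fun s hs hss => ⟨u s, huA s, huc s, (hu s hs).1, ?_⟩⟩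
  obtain ⟨h1, h2⟩ := hsub ⟨hs, hss⟩
  exact h1.le.trans (ENNReal.tsum_le_tsum fun x => ENNReal.rpow_le_rpow (h2 x) hd)

/-! ### One scale, and summation over geometric scales. -/

section Scales

variable {n : ℕ}

/-- Sums the one-ball estimate over the disjoint family: both the local energies and the local `L¹`
errors add up to at most the global ones. Dividing by `s` turns `s^n` per ball into `s^(n-1)` and
the error into order `1/s`. -/
lemma band_energy_lower_bound (hn : 1 ≤ n) {E : Set (EuclideanSpace ℝ (Fin n))}
    (hE : MeasurableSet E) {φ : EuclideanSpace ℝ (Fin n) → ℝ} (hφ : Measurable φ)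
    (hφ1 : ∀ x, φ x ∈ Icc (0 : ℝ) 1) {s a : ℝ} {δ M : ℝ≥0∞}
    (hs : 0 < s) (ha : 0 < a) (hδ : δ ≠ ∞)
    (haδ : volume (Metric.ball (0 : EuclideanSpace ℝ (Fin n)) 1) ^ 2 * ENNReal.ofReal (a ^ n) ≤
      δ ^ 2 / 2)
    {B u : Set (EuclideanSpace ℝ (Fin n))} (huc : u.Countable)
    (hdisj : u.PairwiseDisjoint (fun x => Metric.ball x s))
    (huB : ∀ x ∈ u, Metric.ball x s ⊆ B)
    (hM : M ≤ ∑' _ : u, ENNReal.ofReal (10 * s) ^ ((n : ℝ) - 1))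
    (hdens : ∀ x ∈ u, δ * ENNReal.ofReal (s ^ n) ≤ volume (E ∩ Metric.ball x s) ∧
      δ * ENNReal.ofReal (s ^ n) ≤ volume (Eᶜ ∩ Metric.ball x s)) :
    δ ^ 2 * M ≤
      ENNReal.ofReal (10 ^ n * 2 ^ (n + 3)) *
        (∫⁻ p in distanceBand B (a * s) (2 * s), halfEnergyDensity φ p ∂(volume.prod volume)) +
      ENNReal.ofReal (10 ^ n * 16 / s) *
        (volume (Metric.ball (0 : EuclideanSpace ℝ (Fin n)) 1) *
          ∫⁻ x, ENNReal.ofReal |E.indicator (fun _ => (1 : ℝ)) x - φ x|) := by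
  have := huc.to_subtype
  set ω := volume (Metric.ball (0 : EuclideanSpace ℝ (Fin n)) 1) with hω
  set S := ENNReal.ofReal (s ^ n) with hS
  set e : EuclideanSpace ℝ (Fin n) → ℝ≥0∞ :=
    fun x => ENNReal.ofReal |E.indicator (fun _ => (1 : ℝ)) x - φ x| with he
  set X := ∫⁻ p in distanceBand B (a * s) (2 * s), halfEnergyDensity φ p ∂(volume.prod volume)
  set Y := ∫⁻ x, e x with hY
  have hXsum : ∑' x : u, ∫⁻ p in distanceBand (Metric.ball (x : EuclideanSpace ℝ (Fin n)) s)
      (a * s) (2 * s), halfEnergyDensity φ p ∂(volume.prod volume) ≤ X := by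
    rw [← lintegral_iUnion (fun x => measurableSet_distanceBand measurableSet_ball _ _)]
    · refine lintegral_mono_set (iUnion_subset fun x p hp => ⟨?_, hp.2⟩)
      exact ⟨huB x x.2 hp.1.1, huB x x.2 hp.1.2⟩
    · intro x y hxy
      have h1 : Disjoint (Metric.ball (x : EuclideanSpace ℝ (Fin n)) s) (Metric.ball y s) :=
        hdisj x.2 y.2 fun h => hxy (Subtype.ext h)
      exact Set.disjoint_left.2 fun p hp hq => Set.disjoint_left.1 h1 hp.1.1 hq.1.1
  have hYsum : ∑' x : u, ∫⁻ y in Metric.ball (x : EuclideanSpace ℝ (Fin n)) s, e y ≤ Y := by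
    rw [← lintegral_iUnion (fun x => measurableSet_ball)]
    · exact setLIntegral_le_lintegral _ _
    · exact fun x y hxy => hdisj x.2 y.2 fun h => hxy (Subtype.ext h)
  have hsum : ∑' _ : u, δ ^ 2 * S ≤ ENNReal.ofReal (2 ^ (n + 3) * s) * X + 16 * ω * Y := by
    calc ∑' _ : u, δ ^ 2 * S ≤ ∑' x : u, (ENNReal.ofReal (2 ^ (n + 3) * s) *
          (∫⁻ p in distanceBand (Metric.ball (x : EuclideanSpace ℝ (Fin n)) s) (a * s) (2 * s),
            halfEnergyDensity φ p ∂(volume.prod volume)) +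
          16 * ω * ∫⁻ y in Metric.ball (x : EuclideanSpace ℝ (Fin n)) s, e y) :=
          ENNReal.tsum_le_tsum fun x => density_sq_le_local_energy hn hE hφ hφ1 hs ha hδ haδ
            (hdens x x.2).1 (hdens x x.2).2
      _ ≤ _ := by
          rw [ENNReal.tsum_add, ENNReal.tsum_mul_left, ENNReal.tsum_mul_left]
          gcongr
  have hterm : ENNReal.ofReal s * ENNReal.ofReal (10 * s) ^ ((n : ℝ) - 1) ≤
      ENNReal.ofReal (10 ^ n) * S := by
    have h1 : ((n : ℝ) - 1) = ((n - 1 : ℕ) : ℝ) := by rw [Nat.cast_sub hn]; simp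
    rw [h1, ENNReal.rpow_natCast, ← ENNReal.ofReal_pow (by positivity),
      ← ENNReal.ofReal_mul hs.le, hS, ← ENNReal.ofReal_mul (by positivity)]
    refine ENNReal.ofReal_le_ofReal ?_
    obtain ⟨k, rfl⟩ := Nat.exists_eq_add_of_le hn
    rw [Nat.add_sub_cancel_left, mul_pow, pow_add, pow_add]
    have : 0 ≤ s * 10 ^ k * s ^ k := by positivity
    nlinarith
  have hsM : ENNReal.ofReal s * (δ ^ 2 * M) ≤
      ENNReal.ofReal (10 ^ n) * (ENNReal.ofReal (2 ^ (n + 3) * s) * X + 16 * ω * Y) := by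
    calc ENNReal.ofReal s * (δ ^ 2 * M)
        ≤ ENNReal.ofReal s * (δ ^ 2 * ∑' _ : u, ENNReal.ofReal (10 * s) ^ ((n : ℝ) - 1)) := by
          gcongr
      _ = ∑' _ : u, δ ^ 2 * (ENNReal.ofReal s * ENNReal.ofReal (10 * s) ^ ((n : ℝ) - 1)) := by
          rw [ENNReal.tsum_mul_left, ENNReal.tsum_mul_left]; ring
      _ ≤ ∑' _ : u, δ ^ 2 * (ENNReal.ofReal (10 ^ n) * S) := by gcongr
      _ = ENNReal.ofReal (10 ^ n) * ∑' _ : u, δ ^ 2 * S := by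
          rw [← ENNReal.tsum_mul_left]; congr 1; ext; ring
      _ ≤ _ := by gcongr
  have hs0 : ENNReal.ofReal s ≠ 0 := by simpa using hs
  refine (ENNReal.mul_le_mul_iff_right hs0 ENNReal.ofReal_ne_top).1 (hsM.trans (le_of_eq ?_))
  have e1 : ENNReal.ofReal (10 ^ n) * ENNReal.ofReal (2 ^ (n + 3) * s) =
      ENNReal.ofReal s * ENNReal.ofReal (10 ^ n * 2 ^ (n + 3)) := by
    rw [← ENNReal.ofReal_mul (by positivity), ← ENNReal.ofReal_mul hs.le]
    congr 1; ring
  have e2 : ENNReal.ofReal (10 ^ n) * 16 = ENNReal.ofReal s * ENNReal.ofReal (10 ^ n * 16 / s) := by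
    rw [show (16 : ℝ≥0∞) = ENNReal.ofReal 16 by simp, ← ENNReal.ofReal_mul (by positivity),
      ← ENNReal.ofReal_mul hs.le]
    congr 1; field_simp
  calc _ = (ENNReal.ofReal (10 ^ n) * ENNReal.ofReal (2 ^ (n + 3) * s)) * X +
        (ENNReal.ofReal (10 ^ n) * 16) * (ω * Y) := by ring
    _ = _ := by rw [e1, e2]; ring

/-- Summation over the dyadic-like scales `q ^ j * s`, `j < J`. -/
lemma sum_band_energy_le {φ : EuclideanSpace ℝ (Fin n) → ℝ} (hφ : Measurable φ)
    {B : Set (EuclideanSpace ℝ (Fin n))} (hB : MeasurableSet B) {q s : ℝ} (hq : 0 < q)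
    (hq1 : q < 1) (hs : 0 < s) (J : ℕ) :
    ∑ j ∈ Finset.range J, (∫⁻ p in distanceBand B (2 * q * (q ^ j * s)) (2 * (q ^ j * s)),
      halfEnergyDensity φ p ∂(volume.prod volume)) ≤ halfEnergy φ B := by
  rw [halfEnergy_eq_setLIntegral hφ, ← lintegral_biUnion_finset]
  · exact lintegral_mono_set (iUnion₂_subset fun j _ p hp => hp.1)
  · have hlt : ∀ i j : ℕ, i < j → Disjoint
        (distanceBand B (2 * q * (q ^ i * s)) (2 * (q ^ i * s)))
        (distanceBand B (2 * q * (q ^ j * s)) (2 * (q ^ j * s))) := by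
      intro i j hij
      refine Set.disjoint_left.2 fun p hp hp' => ?_
      have h1 := hp.2.1
      have h2 := hp'.2.2
      have h3 : q ^ j ≤ q ^ (i + 1) := pow_le_pow_of_le_one hq.le hq1.le hij
      have h4 : q ^ j * s ≤ q ^ (i + 1) * s := by gcongr
      rw [pow_succ] at h4
      nlinarith
    intro i _ j _ hij
    rcases lt_or_gt_of_ne hij with h | h
    · exact hlt i j h
    · exact (hlt j i h).symm
  · exact fun j _ => measurableSet_distanceBand hB _ _

lemma sum_inv_geometric_le {q : ℝ} (hq : 0 < q) (hq2 : q ≤ 1 / 2) (J : ℕ) :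
    ∑ j ∈ Finset.range J, (q ^ j)⁻¹ ≤ (q ^ J)⁻¹ := by
  induction J with
  | zero => simp
  | succ J ih =>
    rw [Finset.sum_range_succ]
    have h1 : (q ^ (J + 1))⁻¹ = (q ^ J)⁻¹ * q⁻¹ := by rw [pow_succ, mul_inv]
    have h2 : 2 ≤ q⁻¹ := by rw [le_inv_comm₀ (by norm_num) hq]; simpa using hq2
    have h3 : 0 < (q ^ J)⁻¹ := by positivity
    rw [h1]; nlinarith

end Scales

/-! ### Passage to the limit and the exhaustion argument. -/

lemma ENNReal.le_mul_liminf_of_eventually_le_add {ι : Type*} {l : Filter ι} {f g : ι → ℝ≥0∞}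
    {X K : ℝ≥0∞} (hK : K ≠ 0) (hK' : K ≠ ∞) (hg : Tendsto g l (𝓝 0))
    (h : ∀ᶠ i in l, X ≤ K * f i + g i) : X ≤ K * liminf f l := by
  refine ENNReal.le_of_forall_pos_le_add fun η hη _ => ?_
  have hev : ∀ᶠ i in l, (X - η) / K ≤ f i := by
    filter_upwards [h, hg.eventually (ge_mem_nhds (by simpa using hη : (0 : ℝ≥0∞) < η))] with i hi hgi
    refine ENNReal.div_le_of_le_mul' (tsub_le_iff_right.2 (hi.trans ?_))
    gcongr
  have h1 : (X - η) / K ≤ liminf f l := le_liminf_of_le (by isBoundedDefault) hev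
  rw [← tsub_le_iff_right]
  calc X - η = K * ((X - η) / K) := (ENNReal.mul_div_cancel hK hK').symm
    _ ≤ _ := by gcongr

section Main

variable {n : ℕ}

/-- With `a = 2q` consecutive bands abut without overlapping, so `J` scales give `J` times the
one-scale bound. The errors `ε / (q^j s)` sum to at most `ε q^(-J) / s ≤ 1 / s`, leaving a remainder
independent of `ε` and `J`. -/
lemma nat_mul_le_halfEnergy_mollifiedIndicator (hn : 1 ≤ n) {E : Set (EuclideanSpace ℝ (Fin n))}
    (hE : MeasurableSet E) {μ : Measure (EuclideanSpace ℝ (Fin n))}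
    {σ : EuclideanSpace ℝ (Fin n) → EuclideanSpace ℝ (Fin n)} (hμ : IsPolarGradient E μ σ)
    {B : Set (EuclideanSpace ℝ (Fin n))} (hB : MeasurableSet B) {δ M : ℝ≥0∞} {q s ε : ℝ}
    (hq : 0 < q) (hq2 : q ≤ 1 / 2) (hs : 0 < s) (hε : 0 < ε) (hδ : δ ≠ ∞)
    (hqδ : volume (Metric.ball (0 : EuclideanSpace ℝ (Fin n)) 1) ^ 2 *
      ENNReal.ofReal ((2 * q) ^ n) ≤ δ ^ 2 / 2)
    (hsep : ∀ r, 0 < r → r ≤ s → ∃ u : Set (EuclideanSpace ℝ (Fin n)), u.Countable ∧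
      u.PairwiseDisjoint (fun x => Metric.ball x r) ∧ (∀ x ∈ u, Metric.ball x r ⊆ B) ∧
      (∀ x ∈ u, δ * ENNReal.ofReal (r ^ n) ≤ volume (E ∩ Metric.ball x r) ∧
        δ * ENNReal.ofReal (r ^ n) ≤ volume (Eᶜ ∩ Metric.ball x r)) ∧
      M ≤ ∑' _ : u, ENNReal.ofReal (10 * r) ^ ((n : ℝ) - 1))
    {J : ℕ} (hJ : ε ≤ q ^ J) :
    J * (δ ^ 2 * M) ≤
      ENNReal.ofReal (10 ^ n * 2 ^ (n + 3)) * halfEnergy (mollifiedIndicator E ε) B +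
      ENNReal.ofReal (10 ^ n * 16 / s) *
        (volume (Metric.ball (0 : EuclideanSpace ℝ (Fin n)) 1) * ENNReal.ofReal (μ.real univ *
        (∫ x : EuclideanSpace ℝ (Fin n), ‖x‖ * gaussianDensity x))) := by
  set φ := mollifiedIndicator E ε
  set P := μ.real univ * (∫ x : EuclideanSpace ℝ (Fin n), ‖x‖ * gaussianDensity x)
  have hP : 0 ≤ P := mul_nonneg measureReal_nonneg
    (integral_nonneg fun x => mul_nonneg (norm_nonneg _) (gaussianDensity_nonneg _))
  set ω := volume (Metric.ball (0 : EuclideanSpace ℝ (Fin n)) 1)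
  have hφ : Measurable φ := measurable_mollifiedIndicator hE ε
  have hY := lintegral_indicator_sub_mollifiedIndicator_le hμ hE hε
  have hscale : ∀ j ∈ Finset.range J, δ ^ 2 * M ≤ ENNReal.ofReal (10 ^ n * 2 ^ (n + 3)) *
      (∫⁻ p in distanceBand B (2 * q * (q ^ j * s)) (2 * (q ^ j * s)),
        halfEnergyDensity φ p ∂(volume.prod volume)) +
      ENNReal.ofReal (10 ^ n * 16 / (q ^ j * s)) * (ω * ENNReal.ofReal (P * ε)) := by
    intro j _
    obtain ⟨u, huc, hdisj, huB, hdens, hM⟩ := hsep (q ^ j * s) (by positivity)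
      (mul_le_of_le_one_left hs.le (pow_le_one₀ hq.le (by linarith)))
    refine (band_energy_lower_bound hn hE hφ (mollifiedIndicator_mem_Icc hE hε) (by positivity)
      (by positivity : 0 < 2 * q) hδ hqδ huc hdisj huB hM hdens).trans ?_
    gcongr
  have hsum := Finset.sum_le_sum hscale
  rw [Finset.sum_const, Finset.card_range, nsmul_eq_mul, Finset.sum_add_distrib, ← Finset.mul_sum,
    ← Finset.sum_mul] at hsum
  refine hsum.trans ?_
  have hgeom : (∑ j ∈ Finset.range J, ENNReal.ofReal (10 ^ n * 16 / (q ^ j * s))) *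
      ENNReal.ofReal (P * ε) ≤ ENNReal.ofReal (10 ^ n * 16 / s) * ENNReal.ofReal P := by
    rw [← ENNReal.ofReal_sum_of_nonneg fun j _ => by positivity,
      ← ENNReal.ofReal_mul (Finset.sum_nonneg fun j _ => by positivity),
      ← ENNReal.ofReal_mul (by positivity)]
    refine ENNReal.ofReal_le_ofReal ?_
    have h1 : ∑ j ∈ Finset.range J, 10 ^ n * 16 / (q ^ j * s) =
        10 ^ n * 16 / s * ∑ j ∈ Finset.range J, (q ^ j)⁻¹ := by
      rw [Finset.mul_sum]
      refine Finset.sum_congr rfl fun j _ => ?_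
      field_simp
    have h2 := sum_inv_geometric_le hq hq2 J
    have h3 : (q ^ J)⁻¹ * ε ≤ 1 := by
      rw [inv_mul_le_iff₀ (by positivity)]; simpa using hJ
    calc (∑ j ∈ Finset.range J, 10 ^ n * 16 / (q ^ j * s)) * (P * ε)
        ≤ 10 ^ n * 16 / s * (q ^ J)⁻¹ * (P * ε) := by rw [h1]; gcongr
      _ = 10 ^ n * 16 / s * P * ((q ^ J)⁻¹ * ε) := by ring
      _ ≤ 10 ^ n * 16 / s * P * 1 := by gcongr
      _ = _ := mul_one _
  have hband := sum_band_energy_le hφ hB hq (by linarith) hs J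
  have hcomm : (∑ j ∈ Finset.range J, ENNReal.ofReal (10 ^ n * 16 / (q ^ j * s))) *
      (ω * ENNReal.ofReal (P * ε)) ≤ ENNReal.ofReal (10 ^ n * 16 / s) * (ω * ENNReal.ofReal P) := by
    rw [mul_left_comm, mul_left_comm _ ω]
    gcongr
  gcongr

lemma tendsto_abs_log_nhdsGT_zero : Tendsto (fun ε : ℝ => |Real.log ε|) (𝓝[>] 0) atTop :=
  tendsto_abs_atBot_atTop.comp Real.tendsto_log_nhdsGT_zero

lemma exists_nat_pow_ge {q ε : ℝ} (hq : 0 < q) (hq1 : q < 1) (hε : 0 < ε) (hε1 : ε < 1)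
    (hlog : 2 * |Real.log q| ≤ |Real.log ε|) :
    ∃ J : ℕ, ε ≤ q ^ J ∧ |Real.log ε| / (2 * |Real.log q|) ≤ J := by
  rw [abs_of_neg (Real.log_neg hq hq1), abs_of_neg (Real.log_neg hε hε1)] at *
  set l := -Real.log q with hl
  set L := -Real.log ε with hL
  have hl0 : 0 < l := neg_pos.2 (Real.log_neg hq hq1)
  have hL0 : 0 < L := neg_pos.2 (Real.log_neg hε hε1)
  -- The largest admissible `J`; rounding down loses at most half since `L / l ≥ 2`.
  refine ⟨⌊L / l⌋₊, ?_, ?_⟩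
  · rw [← Real.log_le_log_iff hε (by positivity), Real.log_pow]
    have h1 := Nat.floor_le (div_nonneg hL0.le hl0.le)
    rw [le_div_iff₀ hl0] at h1
    linarith
  · have h1 := (Nat.lt_floor_add_one (L / l)).le
    have h2 : 2 ≤ L / l := by rw [le_div_iff₀ hl0]; exact hlog
    have h3 : L / (2 * l) = L / l / 2 := by field_simp
    rw [h3]; linarith

lemma hausdorffMeasure_le_liminf_halfEnergy (hn : 1 ≤ n) {E : Set (EuclideanSpace ℝ (Fin n))}
    (hE : MeasurableSet E) {μ : Measure (EuclideanSpace ℝ (Fin n))}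
    {σ : EuclideanSpace ℝ (Fin n) → EuclideanSpace ℝ (Fin n)} (hμ : IsPolarGradient E μ σ)
    {δ : ℝ≥0∞} {q R r₀ : ℝ} {x₀ : EuclideanSpace ℝ (Fin n)}
    (hq : 0 < q) (hq2 : q ≤ 1 / 2) (hR : 0 < R) (hr₀ : 0 < r₀) (hδ0 : 0 < δ) (hδ : δ ≠ ∞)
    (hqδ : volume (Metric.ball (0 : EuclideanSpace ℝ (Fin n)) 1) ^ 2 *
      ENNReal.ofReal ((2 * q) ^ n) ≤ δ ^ 2 / 2)
    {A : Set (EuclideanSpace ℝ (Fin n))} (hA : A ⊆ Metric.ball x₀ (r₀ / 2))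
    (hdens : ∀ x ∈ A, ∀ r, 0 < r → r ≤ R →
      δ * ENNReal.ofReal (r ^ n) ≤ volume (E ∩ Metric.ball x r) ∧
        δ * ENNReal.ofReal (r ^ n) ≤ volume (Eᶜ ∩ Metric.ball x r)) :
    ENNReal.ofReal (1 / (2 * |Real.log q|)) * δ ^ 2 * Measure.hausdorffMeasure ((n : ℝ) - 1) A ≤
      ENNReal.ofReal (10 ^ n * 2 ^ (n + 3)) *
        liminf (fun ε : ℝ => ENNReal.ofReal (1 / |Real.log ε|) *
          halfEnergy (mollifiedIndicator E ε) (Metric.ball x₀ r₀)) (𝓝[>] 0) := by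
  have hlq : 0 < |Real.log q| := abs_pos.2 (Real.log_neg hq (by linarith)).ne
  set k := ENNReal.ofReal (1 / (2 * |Real.log q|)) * δ ^ 2 with hk
  have hk0 : k ≠ 0 := mul_ne_zero (by simpa using hlq.ne') (pow_ne_zero _ hδ0.ne')
  have hkt : k ≠ ∞ := ENNReal.mul_ne_top ENNReal.ofReal_ne_top (ENNReal.pow_ne_top hδ)
  rw [mul_comm k, ← ENNReal.le_div_iff_mul_le (Or.inl hk0) (Or.inl hkt)]
  -- The separation scale depends on `M`, so `M` is fixed before `ε → 0`. This also covers infinite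
  -- Hausdorff measure.
  refine le_of_forall_lt_imp_le_of_dense fun M hM => ?_
  rw [ENNReal.le_div_iff_mul_le (Or.inl hk0) (Or.inl hkt)]
  have hn' : (0 : ℝ) ≤ (n : ℝ) - 1 := by
    have : (1 : ℝ) ≤ n := by exact_mod_cast hn
    linarith
  obtain ⟨s₀, hs₀, hsep⟩ := exists_separated_of_lt_hausdorffMeasure hn' hM
  -- The bound `r₀ / 2` keeps balls centred in `B_{r₀/2}(x₀)` inside `B_{r₀}(x₀)`.
  set s := min s₀ (min R (r₀ / 2)) with hs
  have hs0 : 0 < s := lt_min hs₀ (lt_min hR (by positivity))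
  set K := ENNReal.ofReal (10 ^ n * 16 / s) *
        (volume (Metric.ball (0 : EuclideanSpace ℝ (Fin n)) 1) * ENNReal.ofReal (μ.real univ *
        (∫ x : EuclideanSpace ℝ (Fin n), ‖x‖ * gaussianDensity x))) with hK
  have hKt : K ≠ ∞ := ENNReal.mul_ne_top ENNReal.ofReal_ne_top
    (ENNReal.mul_ne_top measure_ball_lt_top.ne ENNReal.ofReal_ne_top)
  have hlim : Tendsto (fun ε : ℝ => ENNReal.ofReal (1 / |Real.log ε|) * K) (𝓝[>] 0) (𝓝 0) := by
    have h1 : Tendsto (fun ε : ℝ => ENNReal.ofReal (1 / |Real.log ε|)) (𝓝[>] 0) (𝓝 0) := by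
      have h2 := ENNReal.tendsto_ofReal (tendsto_abs_log_nhdsGT_zero.const_div_atTop 1)
      rwa [ENNReal.ofReal_zero] at h2
    have h3 := ENNReal.Tendsto.mul_const h1 (Or.inr hKt)
    rwa [zero_mul] at h3
  refine ENNReal.le_mul_liminf_of_eventually_le_add (by simp) ENNReal.ofReal_ne_top hlim ?_
  filter_upwards [self_mem_nhdsWithin, Ioo_mem_nhdsGT (one_pos : (0 : ℝ) < 1),
    tendsto_abs_log_nhdsGT_zero.eventually_ge_atTop (2 * |Real.log q|)] with ε hε hε1 hlog
  obtain ⟨J, hJ, hJL⟩ := exists_nat_pow_ge hq (by linarith) hε hε1.2 hlog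
  have hlε : 0 < |Real.log ε| := by linarith
  have hmain := nat_mul_le_halfEnergy_mollifiedIndicator hn hE hμ
    (measurableSet_ball (x := x₀) (ε := r₀)) hq hq2 hs0 hε hδ hqδ (M := M) (fun r hr hrs => by
      obtain ⟨u, huA, huc, hdisj, hMu⟩ := hsep r hr (hrs.trans (min_le_left _ _))
      have hrR : r ≤ R := hrs.trans ((min_le_right _ _).trans (min_le_left _ _))
      have hrr : r ≤ r₀ / 2 := hrs.trans ((min_le_right _ _).trans (min_le_right _ _))
      refine ⟨u, huc, hdisj, fun x hx => Metric.ball_subset_ball' ?_,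
        fun x hx => hdens x (huA hx) r hr hrR, hMu⟩
      have := Metric.mem_ball.1 (hA (huA hx))
      linarith) hJ
  calc M * k = ENNReal.ofReal (1 / |Real.log ε|) *
        (ENNReal.ofReal (|Real.log ε| / (2 * |Real.log q|)) * (δ ^ 2 * M)) := by
        rw [← mul_assoc (ENNReal.ofReal _), ← ENNReal.ofReal_mul (by positivity), hk]
        have : 1 / |Real.log ε| * (|Real.log ε| / (2 * |Real.log q|)) = 1 / (2 * |Real.log q|) := by
          field_simp
        rw [this]; ring
    _ ≤ ENNReal.ofReal (1 / |Real.log ε|) * ((J : ℝ≥0∞) * (δ ^ 2 * M)) := by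
        gcongr
        exact ENNReal.ofReal_le_of_le_toReal (by simpa using hJL)
    _ ≤ _ := mul_le_mul_right hmain _
    _ = _ := by rw [mul_add, mul_left_comm]

lemma exists_ratio_volume_ball_le (hn : 1 ≤ n) {δ : ℝ≥0∞} (hδ : 0 < δ) :
    ∃ q : ℝ, 0 < q ∧ q ≤ 1 / 2 ∧
      volume (Metric.ball (0 : EuclideanSpace ℝ (Fin n)) 1) ^ 2 * ENNReal.ofReal ((2 * q) ^ n) ≤
        δ ^ 2 / 2 := by
  have hlim : Tendsto (fun q : ℝ => volume (Metric.ball (0 : EuclideanSpace ℝ (Fin n)) 1) ^ 2 *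
      ENNReal.ofReal ((2 * q) ^ n)) (𝓝[>] 0) (𝓝 0) := by
    have h1 : Tendsto (fun q : ℝ => ENNReal.ofReal ((2 * q) ^ n)) (𝓝 0)
        (𝓝 (ENNReal.ofReal ((2 * 0) ^ n))) :=
      (ENNReal.continuous_ofReal.comp (by fun_prop : Continuous fun q : ℝ => (2 * q) ^ n)).tendsto 0
    have h2 := ENNReal.Tendsto.const_mul (h1.mono_left (nhdsWithin_le_nhds (s := Ioi 0)))
      (Or.inr (ENNReal.pow_ne_top (n := 2) (measure_ball_lt_top (μ := volume)
        (x := (0 : EuclideanSpace ℝ (Fin n))) (r := 1)).ne))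
    simpa [zero_pow (show n ≠ 0 by omega)] using h2
  have hpos : 0 < δ ^ 2 / 2 := ENNReal.div_pos (pow_ne_zero _ hδ.ne') (by norm_num)
  obtain ⟨q, hqle, hq, hq2⟩ := ((hlim.eventually (ge_mem_nhds hpos)).and
    (Ioc_mem_nhdsGT (by norm_num : (0 : ℝ) < 1 / 2))).exists
  exact ⟨q, hq, hq2, hqle⟩

end Main

theorem lemma2 (n : ℕ) (hn : 1 ≤ n) :
    ∃ c : ℝ, 0 < c ∧
      ∀ E : Set (EuclideanSpace ℝ (Fin n)), IsFinitePerimeter E →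
      ∀ x₀ ∈ reducedBoundary E, ∀ r₀ : ℝ, 0 < r₀ →
        ENNReal.ofReal c *
            Measure.hausdorffMeasure ((n : ℝ) - 1) (Metric.ball x₀ (r₀ / 2) ∩ reducedBoundary E) ≤
          liminf (fun ε : ℝ => ENNReal.ofReal (1 / |Real.log ε|) *
            halfEnergy (mollifiedIndicator E ε) (Metric.ball x₀ r₀)) (𝓝[>] 0) := by
  obtain ⟨δ, hδ0, hδ, hdens⟩ := exists_reducedBoundary_density hn
  obtain ⟨q, hq, hq2, hqδ⟩ := exists_ratio_volume_ball_le hn hδ0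
  have hlq : 0 < |Real.log q| := abs_pos.2 (Real.log_neg hq (by linarith)).ne
  set k := ENNReal.ofReal (1 / (2 * |Real.log q|)) * δ ^ 2 with hk
  have hk0 : k ≠ 0 := mul_ne_zero (by simpa using hlq.ne') (pow_ne_zero _ hδ0.ne')
  have hkt : k ≠ ∞ := ENNReal.mul_ne_top ENNReal.ofReal_ne_top (ENNReal.pow_ne_top hδ)
  set K := ENNReal.ofReal (10 ^ n * 2 ^ (n + 3)) with hK
  have hK0 : K ≠ 0 := by simp [hK]
  have hKt : K ≠ ∞ := ENNReal.ofReal_ne_top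
  have hkK : k / K ≠ ∞ := ENNReal.div_ne_top hkt hK0
  refine ⟨(k / K).toReal, ENNReal.toReal_pos (ENNReal.div_ne_zero.2 ⟨hk0, hKt⟩) hkK, ?_⟩
  rintro E ⟨hEnull, μ, σ, hμ⟩ x₀ - r₀ hr₀
  -- Neither side of the inequality sees a null modification of `E`, so a measurable representative
  -- suffices.
  obtain ⟨F, -, hF, hFE⟩ := hEnull.exists_measurable_superset_ae_eq
  have hmol : ∀ ε, mollifiedIndicator E ε = mollifiedIndicator F ε :=
    mollifiedIndicator_congr_ae hFE.symm
  rw [ENNReal.ofReal_toReal hkK, reducedBoundary_congr_ae hFE.symm]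
  simp_rw [hmol]
  -- Points whose density bounds hold up to the uniform radius `1 / (i + 1)`. The constant does not
  -- depend on that radius, and continuity along increasing unions holds without measurability of
  -- these sets.
  set A : ℕ → Set (EuclideanSpace ℝ (Fin n)) := fun i =>
    {x ∈ Metric.ball x₀ (r₀ / 2) | ∀ r, 0 < r → r ≤ 1 / ((i : ℝ) + 1) →
      δ * ENNReal.ofReal (r ^ n) ≤ volume (F ∩ Metric.ball x r) ∧
        δ * ENNReal.ofReal (r ^ n) ≤ volume (Fᶜ ∩ Metric.ball x r)} with hA
  have hAmono : Monotone A := fun i j hij x hx => ⟨hx.1, fun r hr hrj => hx.2 r hr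
    (hrj.trans (Nat.one_div_le_one_div hij))⟩
  have hAcover : Metric.ball x₀ (r₀ / 2) ∩ reducedBoundary F ⊆ ⋃ i, A i := by
    rintro x ⟨hx, hxF⟩
    obtain ⟨R, hR, hRd⟩ := hdens F hF x hxF
    obtain ⟨i, hi⟩ := exists_nat_one_div_lt hR
    exact mem_iUnion.2 ⟨i, hx, fun r hr hri => hRd r hr (hri.trans hi.le)⟩
  set L := liminf (fun ε : ℝ => ENNReal.ofReal (1 / |Real.log ε|) *
            halfEnergy (mollifiedIndicator F ε) (Metric.ball x₀ r₀)) (𝓝[>] 0) with hL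
  have hAle : ∀ i, Measure.hausdorffMeasure ((n : ℝ) - 1) (A i) ≤ K * L / k := fun i => by
    rw [ENNReal.le_div_iff_mul_le (Or.inl hk0) (Or.inl hkt), mul_comm]
    exact hausdorffMeasure_le_liminf_halfEnergy hn hF (hμ.congr_ae hFE.symm) hq hq2
      (Nat.one_div_pos_of_nat (n := i)) hr₀ hδ0 hδ hqδ (fun x hx => hx.1) (fun x hx => hx.2)
  have hSle : Measure.hausdorffMeasure ((n : ℝ) - 1)
      (Metric.ball x₀ (r₀ / 2) ∩ reducedBoundary F) ≤ K * L / k := by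
    refine (measure_mono hAcover).trans ?_
    rw [hAmono.measure_iUnion]
    exact iSup_le hAle
  calc k / K * Measure.hausdorffMeasure ((n : ℝ) - 1)
        (Metric.ball x₀ (r₀ / 2) ∩ reducedBoundary F)
      ≤ k / K * (K * L / k) := by gcongr
    _ = (k * k⁻¹) * (K * K⁻¹) * L := by simp only [div_eq_mul_inv]; ring
    _ = L := by rw [ENNReal.mul_inv_cancel hk0 hkt, ENNReal.mul_inv_cancel hK0 hKt]; simp
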